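/- **Model.** A store has $m$ servers and $r$ videos. Video $i$ consists of $L_i\ge 1$ segments of playback length $\tau>0$. Each segment is encoded into coded chunks, one on each server of a set $\mathcal S_i$, so that the chunks from any $k_i\ge 1$ of these servers suffice to recover the segment. Requests for video $i$ form a Poisson process of rate $\lambda_i>0$, independently over $i$. Under probabilistic scheduling, each request for video $i$ is sent, independently of everything else, to a random set $\mathcal A_i\subseteq\mathcal S_i$ with $|\mathcal A_i|=k_i$, drawn from a fixed distribution; $\pi_{ij}=\mathbb P(j\in\mathcal A_i)$. At each server of $\mathcal A_i$ it requests all $L_i$ chunks of video $i$ held there. Each server works at unit rate, first-in-first-out. All chunk service times are independent, and at server $j$ they have the shifted exponential density $\alpha_je^{-\alpha_j(x-\beta_j)}\mathbf 1_{x\ge\beta_j}$, where $\alpha_j>0$ and $\beta_j\ge0$. The system is in steady state. Consider a request for video $i$. Let $W_j$ be the waiting time at server $j$, that is, the work that the request finds in the queue there, and let $Y_j^{(1)},Y_j^{(2)},\dots$ be the service times of its chunks at server $j$. Put $D_{i,j}^{(q)}=W_j+\sum_{v=1}^qY_j^{(v)}$ and $D_i^{(q)}=\max_{j\in\mathcal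 A_i}D_{i,j}^{(q)}$. With start-up delay $d_s\ge 0$, segment $q$ starts to play at time $T_i^{(q)}$, where $T_i^{(1)}=\max(d_s,D_i^{(1)})$ and $T_i^{(q)}=\max(T_i^{(q-1)}+\tau,D_i^{(q)})$ for $1<q\le L_i$. The stall duration is $\Gamma^{(i)}=T_i^{(L_i)}-d_s-(L_i-1)\tau$. **Notation.** Let $$\Lambda_j=\sum_{f=1}^r\lambda_f\pi_{fj},\qquad \rho_j=\sum_{f=1}^r\pi_{fj}\lambda_fL_f\Big(\beta_j+\frac1{\alpha_j}\Big),\qquad M_j(t)=\frac{\alpha_je^{\beta_jt}}{\alpha_j-t},$$ $$B_j(t)=\sum_{f=1}^r\frac{\pi_{fj}\lambda_f}{\Lambda_j}M_j(t)^{L_f},\qquad \widetilde M_j(t)=M_j(t)e^{-t\tau},$$ $$H_{ij}=\frac{e^{-t_i(d_s-\tau)}(1-\rho_j)\,t_i\,B_j(t_i)\,\widetilde M_j(t_i)}{t_i-\Lambda_j(B_j(t_i)-1)}\cdot\frac{1-\widetilde M_j(t_i)^{L_i}}{1-\widetilde M_j(t_i)},$$ where the last quotient is read as $L_i$ if $\widetilde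 M_j(t_i)=1$, and terms with $\pi_{ij}=0$ in the sum below count as $0$. **Theorem.** Let $t_i>0$ be such that, for every server $j$, $t_i<\alpha_j$, $\rho_j<1$ and $$\sum_{f=1}^r\pi_{fj}\lambda_f\Big(\frac{\alpha_je^{\beta_jt_i}}{\alpha_j-t_i}\Big)^{L_f}-(\Lambda_j+t_i)<0 .$$ Then the stall duration of video $i$ is integrable and $$\mathbb E[\Gamma^{(i)}]\le\frac1{t_i}\log\Big(\sum_{j=1}^m\pi_{ij}(1+H_{ij})\Big).$$ -/

import Mathlib

open MeasureTheory ProbabilityTheory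
open scoped NNReal ENNReal

namespace VideoStall

noncomputable section

/-- Parameters of an erasure-coded video store with `r` videos and `m` servers, operated under a
probabilistic scheduling policy. -/
structure Params (r m : ℕ) where
  /-- number of segments of each video -/
  L : Fin r → ℕ
  L_pos : ∀ i, 1 ≤ L i
  /-- number of chunks of a segment that suffice to decode it -/
  k : Fin r → ℕ
  k_pos : ∀ i, 1 ≤ k i
  /-- servers that hold the coded chunks of a video (their number is the code length) -/
  placement : Fin r → Finset (Fin m)
  /-- `policy i A` is the probability that a request for video `i` is sent to the server set `A` -/
  policy : Fin r → Finset (Fin m) → ℝ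
  policy_nonneg : ∀ i A, 0 ≤ policy i A
  policy_sum : ∀ i, ∑ A, policy i A = 1
  policy_support : ∀ i A, policy i A ≠ 0 → A ⊆ placement i ∧ A.card = k i
  /-- request rates -/
  lam : Fin r → ℝ≥0
  lam_pos : ∀ i, 0 < lam i
  /-- exponential rates of the chunk service times -/
  α : Fin m → ℝ
  α_pos : ∀ j, 0 < α j
  /-- shifts of the chunk service times -/
  β : Fin m → ℝ
  β_nonneg : ∀ j, 0 ≤ β j
  /-- playback length of a segment -/
  τ : ℝ
  τ_pos : 0 < τ
  /-- start-up delay -/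
  ds : ℝ
  ds_nonneg : 0 ≤ ds

namespace Params

variable {r m : ℕ} (S : Params r m)

/-- `π i j`: the probability that a request for video `i` uses server `j`. -/
def usage (i : Fin r) (j : Fin m) : ℝ := ∑ A with j ∈ A, S.policy i A

/-- `Λ j`: aggregate arrival rate at server `j`. -/
def Lam (j : Fin m) : ℝ := ∑ f, (S.lam f : ℝ) * S.usage f j

/-- `ρ j`: utilization of server `j`. -/
def rho (j : Fin m) : ℝ :=
  ∑ f, S.usage f j * (S.lam f : ℝ) * (S.L f : ℝ) * (S.β j + 1 / S.α j)

/-- Closed form of the moment generating function of a chunk service time (`t < α j`). -/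
def M (j : Fin m) (t : ℝ) : ℝ := S.α j * Real.exp (S.β j * t) / (S.α j - t)

/-- Closed form of the moment generating function of the service time of a request at server `j`.
It is meaningful only if `Λ j > 0`. -/
def B (j : Fin m) (t : ℝ) : ℝ :=
  ∑ f, S.usage f j * (S.lam f : ℝ) / S.Lam j * (S.M j t) ^ (S.L f)

/-- `M̃ j t = M j t * e ^ (- t τ)`. -/
def Mtilde (j : Fin m) (t : ℝ) : ℝ := S.M j t * Real.exp (-t * S.τ)

open Classical in
/-- `(1 - x ^ n) / (1 - x)`, with its limiting value `n` at `x = 1`. -/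
def geomQuot (x : ℝ) (n : ℕ) : ℝ := if x = 1 then (n : ℝ) else (1 - x ^ n) / (1 - x)

/-- The closed-form expression `H i j`, as a function of `t`. -/
def H (i : Fin r) (j : Fin m) (t : ℝ) : ℝ :=
  Real.exp (-t * (S.ds - S.τ)) * (1 - S.rho j) * t * S.B j t * S.Mtilde j t /
      (t - S.Lam j * (S.B j t - 1)) *
    geomQuot (S.Mtilde j t) (S.L i)

end Params

/-- The shifted exponential distribution, given by its density. -/
def shiftedExp (α β : ℝ) : Measure ℝ :=
  volume.withDensity fun x =>
    ENNReal.ofReal (if β ≤ x then α * Real.exp (-α * (x - β)) else 0)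

/-- `N` is a Poisson process with the given rate: `N s` counts the arrivals in `(0, s]`. -/
structure IsPoissonProcess {Ω : Type*} [MeasurableSpace Ω] (P : Measure Ω) (rate : ℝ≥0)
    (N : ℝ≥0 → Ω → ℕ) : Prop where
  measurable : ∀ s, Measurable (N s)
  zero : ∀ ω, N 0 ω = 0
  mono : ∀ ω, Monotone fun s => N s ω
  right_cont : ∀ ω s, ContinuousWithinAt (fun u => N u ω) (Set.Ici s) s
  law : ∀ s t, s ≤ t → HasLaw (fun ω => N t ω - N s ω) (poissonMeasure (rate * (t - s))) P
  indep : HasIndepIncrements N P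

/-- The independent sources of randomness of the system: the backlogs at time `0`, the request
stream of each video, and, for the `n`-th request of video `f` after time `0`, the set of servers
chosen for it and its chunk service times. -/
inductive Source (r m : ℕ) : Type
  | initial : Source r m
  | stream (f : Fin r) : Source r m
  | choice (f : Fin r) (n : ℕ) : Source r m
  | chunk (f : Fin r) (n : ℕ) (j : Fin m) (v : ℕ) : Source r m

/-- The work (total service time of chunks) that the requests arriving in `(0, s]` bring to server
`j`: a request brings all its `L f` chunks to every server of its chosen set, and nothing to the
others. The requests of each video are numbered from `0` in the order of their arrival. -/
def workload {r m : ℕ} {Ω : Type*} (S : Params r m) (count : Fin r → ℝ≥0 → Ω → ℕ)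
    (choice : Fin r → ℕ → Ω → Finset (Fin m)) (chunk : Fin r → ℕ → Fin m → ℕ → Ω → ℝ)
    (j : Fin m) (s : ℝ≥0) (ω : Ω) : ℝ :=
  ∑ f, ∑ n ∈ Finset.range (count f s ω),
    if j ∈ choice f n ω then ∑ v ∈ Finset.range (S.L f), chunk f n j v ω else 0

/-- A store in steady state, observed from time `0` on: for every video a Poisson stream of
requests, every request being dispatched by probabilistic scheduling, and at each server a
first-in-first-out queue that is served at unit rate. -/
structure SteadyStore {r m : ℕ} (S : Params r m) {Ω : Type*} [MeasurableSpace Ω]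
    (P : Measure Ω) where
  /-- `count f s`: the number of requests for video `f` in `(0, s]` -/
  count : Fin r → ℝ≥0 → Ω → ℕ
  /-- `choice f n`: the set of servers to which the `n`-th request for video `f` is sent -/
  choice : Fin r → ℕ → Ω → Finset (Fin m)
  /-- `chunk f n j v`: the service time at server `j` of chunk `v` of the `n`-th request for `f`
  (relevant if that request is sent to `j`) -/
  chunk : Fin r → ℕ → Fin m → ℕ → Ω → ℝ
  /-- `backlog j s`: the remaining service time of all chunks in the queue of server `j` at
  time `s` -/
  backlog : Fin m → ℝ≥0 → Ω → ℝ
  poisson : ∀ f, IsPoissonProcess P (S.lam f) (count f)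
  choice_measurable : ∀ f n, Measurable (choice f n)
  choice_law : ∀ f n A, P {ω | choice f n ω = A} = ENNReal.ofReal (S.policy f A)
  chunk_measurable : ∀ f n j v, Measurable (chunk f n j v)
  chunk_law : ∀ f n j v, HasLaw (chunk f n j v) (shiftedExp (S.α j) (S.β j)) P
  backlog_measurable : ∀ j s, Measurable (backlog j s)
  indep : iIndep (fun x : Source r m => match x with
    | .initial => MeasurableSpace.comap (fun ω j => backlog j 0 ω) inferInstance
    | .stream f => MeasurableSpace.comap (fun ω s => count f s ω) inferInstance
    | .choice f n => MeasurableSpace.comap (choice f n) inferInstance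
    | .chunk f n j v => MeasurableSpace.comap (chunk f n j v) inferInstance) P
  /-- every server works at unit rate whenever its queue is not empty -/
  dynamics : ∀ᵐ ω ∂P, ∀ j s, 0 ≤ backlog j s ω ∧
    backlog j s ω = backlog j 0 ω + workload S count choice chunk j s ω
      - volume.real {u : ℝ | 0 ≤ u ∧ u < s ∧ 0 < backlog j u.toNNReal ω}
  /-- equilibrium: the joint law of the backlogs does not change with time -/
  steady : ∀ s, IdentDistrib (fun ω j => backlog j s ω) (fun ω j => backlog j 0 ω) P P

/-- The sources of randomness of one request: the backlogs that it finds, the set of servers chosen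
for it, and its chunk service times. -/
inductive RequestSource (m : ℕ) : Type
  | found : RequestSource m
  | choice : RequestSource m
  | chunk (j : Fin m) (v : ℕ) : RequestSource m

/-- A request for video `i` that arrives at time `s` and joins the queues of the servers of its
chosen set. Its chunks are numbered from `0`. -/
structure Request {r m : ℕ} {S : Params r m} {Ω : Type*} [MeasurableSpace Ω] {P : Measure Ω}
    (Q : SteadyStore S P) (i : Fin r) (s : ℝ≥0) where
  /-- the set of servers to which the request is sent -/
  choice : Ω → Finset (Fin m)
  /-- the service times of its chunks at each server -/
  chunk : Fin m → ℕ → Ω → ℝ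
  choice_measurable : Measurable choice
  choice_law : ∀ A, P {ω | choice ω = A} = ENNReal.ofReal (S.policy i A)
  chunk_measurable : ∀ j v, Measurable (chunk j v)
  chunk_law : ∀ j v, HasLaw (chunk j v) (shiftedExp (S.α j) (S.β j)) P
  indep : iIndep (fun x : RequestSource m => match x with
    | .found => MeasurableSpace.comap (fun ω j => Q.backlog j s ω) inferInstance
    | .choice => MeasurableSpace.comap choice inferInstance
    | .chunk j v => MeasurableSpace.comap (chunk j v) inferInstance) P

namespace Request

variable {r m : ℕ} {S : Params r m} {Ω : Type*} [MeasurableSpace Ω] {P : Measure Ω}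
  {Q : SteadyStore S P} {i : Fin r} {s : ℝ≥0} (R : Request Q i s)

/-- Waiting time at server `j`: under first-in-first-out service at unit rate, this is the work
found in the queue. -/
def wait (_R : Request Q i s) (j : Fin m) (ω : Ω) : ℝ := Q.backlog j s ω

/-- Download time (since the arrival) of the `q`-th chunk from server `j`, `q = 1, …, L i`. -/
def download (j : Fin m) (q : ℕ) (ω : Ω) : ℝ :=
  R.wait j ω + ∑ v ∈ Finset.range q, R.chunk j v ω

/-- Download time of the `q`-th segment: the maximum over the chosen servers. -/
def segmentDownload (q : ℕ) (ω : Ω) : ℝ :=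
  if h : (R.choice ω).Nonempty then (R.choice ω).sup' h fun j => R.download j q ω else 0

/-- The time (since the arrival) at which the play of segment `q ≥ 1` starts; the value at `q = 0`
is a placeholder. -/
def playTime : ℕ → Ω → ℝ
  | 0, _ => 0
  | 1, ω => max S.ds (R.segmentDownload 1 ω)
  | q + 2, ω => max (playTime (q + 1) ω + S.τ) (R.segmentDownload (q + 2) ω)

/-- The stall duration. -/
def stall (ω : Ω) : ℝ := R.playTime (S.L i) ω - S.ds - ((S.L i : ℝ) - 1) * S.τ

end Request

end

end VideoStall

namespace VideoStall

open Filter Topology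

/-! Unrolling the playback recursion shows that the stall is at most the larger of `0` and the
maximum of `D_j^(p+1) - pτ - ds` over the chosen servers `j` and `0 ≤ p < L_i`. Bounding the
exponential of a maximum by a sum, and using independence of the choice, the backlog and the chunks,
bounds `E exp(tΓ)` by a sum over servers of `π_ij (1 + ∑_p exp(-t(ds + pτ)) E exp(tW_j) M_j^(p+1))`.
The sum over `p` is geometric and is at most `H`; Jensen's inequality for the exponential then
yields the logarithm.

What remains is the Pollaczek–Khinchine bound `E exp(tW) ≤ (1 - ρ) t / (t - φ(t))`, where `φ` is the
exponent of the compound Poisson work: `E exp(tA(h)) = exp(hφ(t))`. It is derived from stationarity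
over a short interval of length `h`. The queue satisfies `W(h) ≤ max(W(0) - h, 0) + A(h)` with
`A(h)` independent of `W(0)`; comparing exponential moments and letting `h → 0` gives the bound with
`P(W = 0)` in place of `1 - ρ` (`lintegral_exp_backlog_le_mul_idle`). In the mean, arriving work
cannot exceed the work served, so `ρ ≤ P(W > 0)` (`rho_le_measure_busy`). -/

/-! ### Measurability of random sums and of events about random sets. -/

theorem measurable_sum_range_comp {Ω : Type*} {_ : MeasurableSpace Ω} {N : Ω → ℕ} {X : ℕ → Ω → ℝ}
    (hN : Measurable N)
    (hX : ∀ n, Measurable (X n)) : Measurable fun ω => ∑ n ∈ Finset.range (N ω), X n ω := by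
  have h : Measurable fun p : ℕ × Ω => ∑ n ∈ Finset.range p.1, X n p.2 :=
    measurable_from_prod_countable_right fun k =>
      Finset.measurable_fun_sum (Finset.range k) fun n _ => hX n
  exact h.comp (hN.prodMk measurable_id)

theorem measurable_mem_finset {Ω α : Type*} {_ : MeasurableSpace Ω} [Finite α] {C : Ω → Finset α}
    (hC : Measurable C) (j : α) :
    MeasurableSet {ω | j ∈ C ω} :=
  hC (Set.toFinite {A : Finset α | j ∈ A}).measurableSet

open Classical in
theorem measurable_ite_mem_finset {Ω α : Type*} {_ : MeasurableSpace Ω} [Finite α]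
    {C : Ω → Finset α} (hC : Measurable C) (j : α)
    {X : Ω → ℝ} (hX : Measurable X) : Measurable fun ω => if j ∈ C ω then X ω else 0 :=
  Measurable.ite (measurable_mem_finset hC j) hX measurable_const

theorem measurable_indicator_one {Ω : Type*} {_ : MeasurableSpace Ω} {A : Set Ω}
    (hA : MeasurableSet A) :
    Measurable (A.indicator (1 : Ω → ℝ≥0∞)) :=
  measurable_one.indicator hA

theorem measurable_ofReal_exp_mul {Ω : Type*} {_ : MeasurableSpace Ω} {X : Ω → ℝ}
    (hX : Measurable X)
    (t : ℝ) : Measurable fun ω => ENNReal.ofReal (Real.exp (t * X ω)) :=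
  ENNReal.measurable_ofReal.comp (Real.measurable_exp.comp (hX.const_mul t))

theorem measurable_biSup_of_mem {Ω ι E : Type*} {m : ι → MeasurableSpace Ω} [MeasurableSpace E]
    {f : Ω → E} {i : ι} (hf : Measurable[m i] f) {I : Set ι} (hi : i ∈ I) :
    Measurable[⨆ i ∈ I, m i] f :=
  hf.mono (le_biSup m hi) le_rfl

/-! ### Factorization over independent blocks of sources. -/

section Independence

variable {Ω ι κ : Type*} {mΩ : MeasurableSpace Ω} {P : Measure Ω}

/-- Expectations of products of nonnegative functions of disjoint blocks of independent sources. -/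
theorem lintegral_mul_prod_of_iIndep {m : ι → MeasurableSpace Ω} (h_le : ∀ i, m i ≤ mΩ)
    (h_indep : iIndep m P) (I₀ : Set ι) (I : κ → Set ι) (h₀ : ∀ k, Disjoint (I k) I₀)
    (hI : ∀ k l, k ≠ l → Disjoint (I k) (I l)) {F₀ : Ω → ℝ≥0∞} {F : κ → Ω → ℝ≥0∞}
    (hF₀ : Measurable[⨆ i ∈ I₀, m i] F₀) (hF : ∀ k, Measurable[⨆ i ∈ I k, m i] (F k))
    (s : Finset κ) :
    ∫⁻ ω, F₀ ω * ∏ k ∈ s, F k ω ∂P = (∫⁻ ω, F₀ ω ∂P) * ∏ k ∈ s, ∫⁻ ω, F k ω ∂P := by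
  classical
  induction s using Finset.induction_on with
  | empty => simp
  | insert a s ha ih =>
    let T : Set ι := I₀ ∪ ⋃ k ∈ s, I k
    have hT : Disjoint (I a) T := by
      rw [Set.disjoint_union_right]
      refine ⟨h₀ a, ?_⟩
      simp only [Set.disjoint_iUnion_right]
      intro k hk
      exact hI a k (by rintro rfl; exact ha hk)
    have hsub : ∀ S : Set ι, S ⊆ T → (⨆ i ∈ S, m i) ≤ ⨆ i ∈ T, m i :=
      fun S hS => biSup_mono hS
    have hG : Measurable[⨆ i ∈ T, m i] fun ω => F₀ ω * ∏ k ∈ s, F k ω := by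
      refine Measurable.mul (hF₀.mono (hsub _ Set.subset_union_left) le_rfl) ?_
      refine Finset.measurable_fun_prod s fun k hk => ?_
      refine (hF k).mono (hsub _ ?_) le_rfl
      exact (Set.subset_biUnion_of_mem (u := I) (Finset.mem_coe.2 hk)).trans
        Set.subset_union_right
    have key := lintegral_mul_eq_lintegral_mul_lintegral_of_independent_measurableSpace
      (iSup₂_le fun i _ => h_le i) (iSup₂_le fun i _ => h_le i)
      (indep_iSup_of_disjoint h_le h_indep hT) (hF a) hG
    calc ∫⁻ ω, F₀ ω * ∏ k ∈ insert a s, F k ω ∂P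
        = ∫⁻ ω, F a ω * (F₀ ω * ∏ k ∈ s, F k ω) ∂P := by
          simp_rw [Finset.prod_insert ha, mul_left_comm]
      _ = _ := by rw [key, ih, Finset.prod_insert ha, mul_left_comm]

theorem measure_mem_finset {α : Type*} [Fintype α] [DecidableEq α] {C : Ω → Finset α}
    (hC : Measurable C)
    {p : Finset α → ℝ} (hp : ∀ A, 0 ≤ p A) (hlaw : ∀ A, P {ω | C ω = A} = ENNReal.ofReal (p A))
    (j : α) : P {ω | j ∈ C ω} = ENNReal.ofReal (∑ A with j ∈ A, p A) := by
  have : {ω | j ∈ C ω} = ⋃ A ∈ Finset.univ.filter (fun A : Finset α => j ∈ A), {ω | C ω = A} := by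
    ext ω; simp
  rw [this, measure_biUnion_finset, ENNReal.ofReal_sum_of_nonneg fun A _ => hp A]
  · exact Finset.sum_congr rfl fun A _ => hlaw A
  · intro A _ B _ hAB
    refine Set.disjoint_left.2 fun ω h₁ h₂ => hAB ?_
    exact h₁.symm.trans h₂
  · exact fun A _ => hC (measurableSet_singleton A)

end Independence

/-! ### Transforms of the shifted exponential and Poisson laws. -/

theorem lintegral_exp_shiftedExp {a b t : ℝ} (ha : 0 < a) (ht : t < a) :
    ∫⁻ x, ENNReal.ofReal (Real.exp (t * x)) ∂(shiftedExp a b)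
      = ENNReal.ofReal (a * Real.exp (b * t) / (a - t)) := by
  have hneg : t - a < 0 := by linarith
  rw [shiftedExp, lintegral_withDensity_eq_lintegral_mul _ _ (by fun_prop)]
  · have h1 : ∀ x, ((fun x => ENNReal.ofReal (if b ≤ x then a * Real.exp (-a * (x - b)) else 0)) *
        fun x => ENNReal.ofReal (Real.exp (t * x))) x = (Set.Ici b).indicator
          (fun x => ENNReal.ofReal (a * Real.exp (a * b) * Real.exp ((t - a) * x))) x := by
      intro x
      by_cases hx : b ≤ x
      · simp only [Pi.mul_apply, hx, if_true, Set.indicator, Set.mem_Ici]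
        rw [← ENNReal.ofReal_mul (by positivity), mul_assoc, mul_assoc, ← Real.exp_add,
          ← Real.exp_add]
        ring_nf
      · simp [hx]
    rw [lintegral_congr h1, lintegral_indicator measurableSet_Ici,
      setLIntegral_congr Ioi_ae_eq_Ici.symm, ← ofReal_integral_eq_lintegral_ofReal,
      integral_const_mul, integral_exp_mul_Ioi hneg]
    · congr 1
      rw [mul_div_assoc', mul_neg, mul_assoc, ← Real.exp_add,
        show a * b + (t - a) * b = b * t by ring, neg_div, ← div_neg, neg_sub]
    · exact (integrableOn_exp_mul_Ioi hneg b).const_mul _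
    · exact Filter.Eventually.of_forall fun x => by positivity
  · refine ENNReal.measurable_ofReal.comp (Measurable.ite measurableSet_Ici ?_ ?_) <;> fun_prop

/-- Nonnegative chunk times make the arriving work nonnegative and monotone in time, which the
pathwise queue bounds need. -/
theorem shiftedExp_Iio_zero {a b : ℝ} (hb : 0 ≤ b) : shiftedExp a b (Set.Iio 0) = 0 := by
  rw [shiftedExp, withDensity_apply _ measurableSet_Iio]
  refine (setLIntegral_congr_fun measurableSet_Iio fun x hx => ?_).trans lintegral_zero
  have : ¬ b ≤ x := not_le.2 (lt_of_lt_of_le hx hb)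
  simp [this]

/-- The Poisson generating function, written over atoms because `lintegral_exp_stream` splits
according to the number of arrivals. -/
theorem lintegral_pow_poissonMeasure (c : ℝ≥0) {g : ℝ} (hg : 0 ≤ g) :
    ∑' n : ℕ, ENNReal.ofReal g ^ n * poissonMeasure c {n}
      = ENNReal.ofReal (Real.exp (c * (g - 1))) := by
  have hsum : HasSum (fun n : ℕ => Real.exp (-c) * ((c * g) ^ n / n.factorial))
      (Real.exp (-c) * Real.exp (c * g)) := by
    have := NormedSpace.expSeries_div_hasSum_exp ((c : ℝ) * g)
    rw [← Real.exp_eq_exp_ℝ] at this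
    exact this.mul_left _
  have h1 : ∀ n : ℕ, ENNReal.ofReal g ^ n * poissonMeasure c {n}
      = ENNReal.ofReal (Real.exp (-c) * ((c * g) ^ n / n.factorial)) := by
    intro n
    rw [poissonMeasure_singleton, ← ENNReal.ofReal_pow hg, ← ENNReal.ofReal_mul (by positivity)]
    congr 1
    rw [mul_pow]; ring
  simp_rw [h1]
  rw [← ENNReal.ofReal_tsum_of_nonneg (fun n => by positivity) hsum.summable, hsum.tsum_eq,
    ← Real.exp_add]
  congr 2; ring

/-- The video that a source of randomness belongs to. -/
def Source.video {r m : ℕ} : Source r m → Option (Fin r)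
  | .initial => none
  | .stream f => some f
  | .choice f _ => some f
  | .chunk f _ _ _ => some f

/-- The request that a source of randomness belongs to. -/
def Source.request {r m : ℕ} : Source r m → Option (Fin r × ℕ)
  | .initial => none
  | .stream _ => none
  | .choice f n => some (f, n)
  | .chunk f n _ _ => some (f, n)

/-! ### The exponent of the arriving work. -/

namespace Params

variable {r m : ℕ} (S : Params r m)

/-- The Laplace exponent of the workload that arrives at server `j`. -/
noncomputable def phi (j : Fin m) (t : ℝ) : ℝ :=
  ∑ f, (S.lam f : ℝ) * (S.usage f j * (S.M j t ^ S.L f - 1))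

theorem usage_nonneg (i : Fin r) (j : Fin m) : 0 ≤ S.usage i j :=
  Finset.sum_nonneg fun A _ => S.policy_nonneg i A

theorem usage_le_one (i : Fin r) (j : Fin m) : S.usage i j ≤ 1 := by
  rw [← S.policy_sum i]
  exact Finset.sum_le_sum_of_subset_of_nonneg (Finset.filter_subset _ _)
    fun A _ _ => S.policy_nonneg i A

theorem M_nonneg {j : Fin m} {t : ℝ} (ht : t < S.α j) : 0 ≤ S.M j t :=
  div_nonneg (mul_nonneg (S.α_pos j).le (Real.exp_nonneg _)) (by linarith)

theorem hasDerivAt_M_zero (j : Fin m) : HasDerivAt (S.M j) (S.β j + 1 / S.α j) 0 := by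
  have hα := (S.α_pos j).ne'
  have h1 : HasDerivAt (fun t => S.α j * Real.exp (S.β j * t)) (S.α j * S.β j) 0 := by
    have := ((hasDerivAt_id (0 : ℝ)).const_mul (S.β j)).exp.const_mul (S.α j)
    simpa using this
  have h2 : HasDerivAt (fun t => S.α j - t) (-1) 0 := by
    simpa using (hasDerivAt_id (0 : ℝ)).const_sub (S.α j)
  refine (h1.div h2 (by simpa using hα)).congr_deriv ?_
  simp only [mul_zero, Real.exp_zero, sub_zero]
  field_simp
  ring

theorem M_zero (j : Fin m) : S.M j 0 = 1 := by
  simp [M, (S.α_pos j).ne']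

/-- The slope at `0` is the mean work per unit time. The comparison of `rho` with the busy
probability uses `rho` only through this slope, so the mean of the work is never computed directly.
-/
theorem hasDerivAt_phi_zero (j : Fin m) : HasDerivAt (S.phi j) (S.rho j) 0 := by
  have h : ∀ f ∈ Finset.univ, HasDerivAt
      (fun t => (S.lam f : ℝ) * (S.usage f j * (S.M j t ^ S.L f - 1)))
      ((S.lam f : ℝ) * (S.usage f j * (S.L f * (S.β j + 1 / S.α j)))) 0 := by
    intro f _
    have := (((S.hasDerivAt_M_zero j).pow (S.L f)).sub_const 1).const_mul (S.usage f j)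
    simpa [S.M_zero] using this.const_mul (S.lam f : ℝ)
  refine (HasDerivAt.fun_sum h).congr_deriv ?_
  exact Finset.sum_congr rfl fun f _ => by ring

theorem phi_zero (j : Fin m) : S.phi j 0 = 0 := by
  simp [phi, S.M_zero]

end Params

/-! ### Exponential moments of the arriving work. -/

namespace SteadyStore

variable {r m : ℕ} {S : Params r m} {Ω : Type*} [mΩ : MeasurableSpace Ω] {P : Measure Ω}

/-- The σ-algebras of the independent sources of randomness. -/
@[reducible]
def source (Q : SteadyStore S P) : Source r m → MeasurableSpace Ω
  | .initial => MeasurableSpace.comap (fun ω j => Q.backlog j 0 ω) inferInstance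
  | .stream f => MeasurableSpace.comap (fun ω s => Q.count f s ω) inferInstance
  | .choice f n => MeasurableSpace.comap (Q.choice f n) inferInstance
  | .chunk f n j v => MeasurableSpace.comap (Q.chunk f n j v) inferInstance

/-- The work that the `n`-th request for video `f` brings to server `j`. -/
def job (Q : SteadyStore S P) (f : Fin r) (n : ℕ) (j : Fin m) (ω : Ω) : ℝ :=
  if j ∈ Q.choice f n ω then ∑ v ∈ Finset.range (S.L f), Q.chunk f n j v ω else 0

/-- The work that arrives at server `j` in `(0, s]`. -/
def work (Q : SteadyStore S P) (j : Fin m) (s : ℝ≥0) (ω : Ω) : ℝ :=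
  workload S Q.count Q.choice Q.chunk j s ω

variable (Q : SteadyStore S P)

theorem work_eq (j : Fin m) (s : ℝ≥0) (ω : Ω) :
    Q.work j s ω = ∑ f, ∑ n ∈ Finset.range (Q.count f s ω), Q.job f n j ω := rfl

theorem iIndep_source : iIndep Q.source P :=
  Q.indep

theorem source_le (x : Source r m) : Q.source x ≤ mΩ := by
  cases x with
  | initial => exact (measurable_pi_lambda _ fun j => Q.backlog_measurable j 0).comap_le
  | stream f => exact (measurable_pi_lambda _ fun s => (Q.poisson f).measurable s).comap_le
  | choice f n => exact (Q.choice_measurable f n).comap_le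
  | chunk f n j v => exact (Q.chunk_measurable f n j v).comap_le

theorem measurable_source_backlog (j : Fin m) : Measurable[Q.source .initial] (Q.backlog j 0) :=
  (measurable_pi_apply j).comp (comap_measurable fun ω j => Q.backlog j 0 ω)

theorem measurable_source_count (f : Fin r) (s : ℝ≥0) :
    Measurable[Q.source (.stream f)] (Q.count f s) :=
  (measurable_pi_apply s).comp (comap_measurable fun ω s => Q.count f s ω)

theorem measurable_biSup_job {I : Set (Source r m)} {f : Fin r} {n : ℕ} (j : Fin m)
    (h₁ : .choice f n ∈ I) (h₂ : ∀ v, .chunk f n j v ∈ I) :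
    Measurable[⨆ x ∈ I, Q.source x] (Q.job f n j) := by
  have hC : Measurable[⨆ x ∈ I, Q.source x] (Q.choice f n) :=
    measurable_biSup_of_mem (m := Q.source) (comap_measurable (Q.choice f n)) h₁
  have hY : Measurable[⨆ x ∈ I, Q.source x]
      fun ω => ∑ v ∈ Finset.range (S.L f), Q.chunk f n j v ω :=
    Finset.measurable_fun_sum _ fun v _ =>
      measurable_biSup_of_mem (m := Q.source) (comap_measurable (Q.chunk f n j v)) (h₂ v)
  convert measurable_ite_mem_finset hC j hY using 2
  unfold job
  congr

theorem measurable_job (f : Fin r) (n : ℕ) (j : Fin m) : Measurable (Q.job f n j) :=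
  (Q.measurable_biSup_job (I := Set.univ) j trivial fun _ => trivial).mono
    (iSup₂_le fun x _ => Q.source_le x) le_rfl

theorem measurable_work (j : Fin m) (s : ℝ≥0) : Measurable (Q.work j s) :=
  Finset.measurable_fun_sum Finset.univ fun f _ =>
    measurable_sum_range_comp ((Q.poisson f).measurable s) fun n => Q.measurable_job f n j

theorem ae_job_nonneg : ∀ᵐ ω ∂P, ∀ f n j, 0 ≤ Q.job f n j ω := by
  have h : ∀ᵐ ω ∂P, ∀ f n j v, 0 ≤ Q.chunk f n j v ω := by
    refine ae_all_iff.2 fun f => ae_all_iff.2 fun n => ae_all_iff.2 fun j => ae_all_iff.2 fun v =>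
        ?_
    have h0 : P {ω | Q.chunk f n j v ω < 0} = 0 := by
      rw [(Q.chunk_law f n j v).measure_eq (p := fun x => x < 0) measurableSet_Iio]
      exact shiftedExp_Iio_zero (S.β_nonneg j)
    rw [ae_iff]
    simpa using h0
  filter_upwards [h] with ω hω f n j
  unfold job
  split_ifs
  · exact Finset.sum_nonneg fun v _ => hω f n j v
  · exact le_rfl

theorem hasLaw_count (f : Fin r) (s : ℝ≥0) : HasLaw (Q.count f s) (poissonMeasure (S.lam f * s)) P
    := by
  have h := (Q.poisson f).law 0 s zero_le
  simpa [(Q.poisson f).zero] using h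

variable [IsProbabilityMeasure P]

/-- The job is zero when the server is not chosen, and otherwise a sum of `L f` independent chunks
that are independent of the choice. -/
theorem lintegral_exp_job (f : Fin r) (n : ℕ) (j : Fin m) {t : ℝ} (ht : t < S.α j) :
    ∫⁻ ω, ENNReal.ofReal (Real.exp (t * Q.job f n j ω)) ∂P
      = ENNReal.ofReal (1 + S.usage f j * (S.M j t ^ S.L f - 1)) := by
  classical
  have hM := S.M_nonneg ht
  have hC : MeasurableSet {ω | j ∈ Q.choice f n ω} := measurable_mem_finset (Q.choice_measurable f
      n) j
  have hCm : MeasurableSet[Q.source (.choice f n)] {ω | j ∈ Q.choice f n ω} :=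
    measurable_mem_finset (comap_measurable (Q.choice f n)) j
  have hP : P {ω | j ∈ Q.choice f n ω} = ENNReal.ofReal (S.usage f j) :=
    measure_mem_finset (Q.choice_measurable f n) (S.policy_nonneg f) (Q.choice_law f n) j
  have hsplit : ∀ ω, ENNReal.ofReal (Real.exp (t * Q.job f n j ω))
      = {ω | j ∈ Q.choice f n ω}ᶜ.indicator 1 ω + {ω | j ∈ Q.choice f n ω}.indicator 1 ω *
        ∏ v ∈ Finset.range (S.L f), ENNReal.ofReal (Real.exp (t * Q.chunk f n j v ω)) := by
    intro ω
    by_cases hω : j ∈ Q.choice f n ω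
    · simp [job, hω, Finset.mul_sum, Real.exp_sum, ENNReal.ofReal_prod_of_nonneg, Real.exp_nonneg]
    · simp [job, hω]
  have hprod := lintegral_mul_prod_of_iIndep Q.source_le Q.iIndep_source {.choice f n}
    (fun v : ℕ => {.chunk f n j v}) (by simp) (by simp)
    (F₀ := {ω | j ∈ Q.choice f n ω}.indicator 1)
    (F := fun v ω => ENNReal.ofReal (Real.exp (t * Q.chunk f n j v ω)))
    (measurable_biSup_of_mem (m := Q.source) (measurable_indicator_one hCm) rfl)
    (fun v => measurable_biSup_of_mem (m := Q.source)
      (measurable_ofReal_exp_mul (comap_measurable (Q.chunk f n j v)) t) rfl)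
    (Finset.range (S.L f))
  have hY : ∀ v, ∫⁻ ω, ENNReal.ofReal (Real.exp (t * Q.chunk f n j v ω)) ∂P
      = ENNReal.ofReal (S.M j t) := fun v => by
    rw [(Q.chunk_law f n j v).lintegral_comp
      (f := fun x => ENNReal.ofReal (Real.exp (t * x))) (by fun_prop),
      lintegral_exp_shiftedExp (S.α_pos j) ht]
    rfl
  rw [lintegral_congr hsplit, lintegral_add_left (measurable_one.indicator hC.compl), hprod,
    lintegral_indicator_one hC, lintegral_indicator_one hC.compl, prob_compl_eq_one_sub hC, hP,
    Finset.prod_congr rfl fun v _ => hY v, Finset.prod_const, Finset.card_range,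
    ← ENNReal.ofReal_one, ← ENNReal.ofReal_sub _ (S.usage_nonneg f j), ← ENNReal.ofReal_pow hM,
    ← ENNReal.ofReal_mul (S.usage_nonneg f j), ← ENNReal.ofReal_add]
  · congr 1; ring
  · linarith [S.usage_le_one f j]
  · exact mul_nonneg (S.usage_nonneg f j) (pow_nonneg hM _)

/-- Compound Poisson formula: the job transform is inserted into the generating function of the
count, which is independent of the jobs. -/
theorem lintegral_exp_stream (f : Fin r) (j : Fin m) (s : ℝ≥0) {t : ℝ} (ht : t < S.α j) :
    ∫⁻ ω, ENNReal.ofReal (Real.exp (t * ∑ n ∈ Finset.range (Q.count f s ω), Q.job f n j ω)) ∂P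
      = ENNReal.ofReal (Real.exp (s * (S.lam f * (S.usage f j * (S.M j t ^ S.L f - 1))))) := by
  have hg : 0 ≤ 1 + S.usage f j * (S.M j t ^ S.L f - 1) := by
    nlinarith [S.usage_le_one f j, mul_nonneg (S.usage_nonneg f j) (pow_nonneg (S.M_nonneg ht) (S.L
        f))]
  have hN : ∀ n : ℕ, MeasurableSet {ω | Q.count f s ω = n} := fun n =>
    (Q.poisson f).measurable s (measurableSet_singleton n)
  have hsplit : ∀ ω, ENNReal.ofReal
      (Real.exp (t * ∑ n ∈ Finset.range (Q.count f s ω), Q.job f n j ω))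
      = ∑' n : ℕ, {ω | Q.count f s ω = n}.indicator 1 ω *
        ∏ k ∈ Finset.range n, ENNReal.ofReal (Real.exp (t * Q.job f k j ω)) := by
    intro ω
    -- The indicators kill every term except the one at the actual count.
    rw [tsum_eq_single (Q.count f s ω)]
    · simp [Finset.mul_sum, Real.exp_sum, ENNReal.ofReal_prod_of_nonneg, Real.exp_nonneg]
    · intro n hn
      simp [hn.symm]
  have hterm : ∀ n : ℕ, ∫⁻ ω, {ω | Q.count f s ω = n}.indicator 1 ω *
        ∏ k ∈ Finset.range n, ENNReal.ofReal (Real.exp (t * Q.job f k j ω)) ∂P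
      = ENNReal.ofReal (1 + S.usage f j * (S.M j t ^ S.L f - 1)) ^ n *
        poissonMeasure (S.lam f * s) {n} := by
    intro n
    have hNm : MeasurableSet[Q.source (.stream f)] {ω | Q.count f s ω = n} :=
      Q.measurable_source_count f s (measurableSet_singleton n)
    have hprod := lintegral_mul_prod_of_iIndep Q.source_le Q.iIndep_source {.stream f}
      (fun k : ℕ => {x | x.request = some (f, k)}) (by simp [Source.request])
      (fun k l hkl => Set.disjoint_left.2 fun x hx hx' => hkl (by
        simpa using (hx.symm.trans hx' : some (f, k) = some (f, l))))
      (F₀ := {ω | Q.count f s ω = n}.indicator 1)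
      (F := fun k ω => ENNReal.ofReal (Real.exp (t * Q.job f k j ω)))
      (measurable_biSup_of_mem (m := Q.source) (measurable_indicator_one hNm) rfl)
      (fun k => measurable_ofReal_exp_mul (Q.measurable_biSup_job
        (I := {x | x.request = some (f, k)}) (f := f) (n := k) j rfl fun v => rfl) t)
      (Finset.range n)
    rw [hprod, lintegral_indicator_one (hN n),
      Finset.prod_congr rfl fun k _ => Q.lintegral_exp_job f k j ht, Finset.prod_const,
      Finset.card_range, mul_comm,
      (Q.hasLaw_count f s).measure_eq (p := fun k => k = n) (measurableSet_singleton n)]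
    rfl
  rw [lintegral_congr hsplit, lintegral_tsum, tsum_congr hterm, lintegral_pow_poissonMeasure _ hg]
  · congr 2
    push_cast
    ring
  · intro n
    refine ((measurable_one.indicator (hN n)).mul
      (Finset.measurable_fun_prod _ fun k _ => ?_)).aemeasurable
    have := Q.measurable_job f k j
    fun_prop

/-- Videos use disjoint blocks of sources, so their exponents add. The factor `F` will be a function
of the initial backlog, which is independent of all later arrivals. -/
theorem lintegral_mul_exp_work (j : Fin m) (s : ℝ≥0) {t : ℝ} (ht : t < S.α j) {F : Ω → ℝ≥0∞}
    (hF : Measurable[Q.source .initial] F) :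
    ∫⁻ ω, F ω * ENNReal.ofReal (Real.exp (t * Q.work j s ω)) ∂P
      = (∫⁻ ω, F ω ∂P) * ENNReal.ofReal (Real.exp (s * S.phi j t)) := by
  have hprod := lintegral_mul_prod_of_iIndep Q.source_le Q.iIndep_source {.initial}
    (fun f : Fin r => {x | x.video = some f}) (by simp [Source.video])
    (fun k l hkl => Set.disjoint_left.2 fun x hx hx' => hkl (by
      simpa using (hx.symm.trans hx' : some k = some l)))
    (F₀ := F)
    (F := fun f ω => ENNReal.ofReal
      (Real.exp (t * ∑ n ∈ Finset.range (Q.count f s ω), Q.job f n j ω)))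
    (measurable_biSup_of_mem (m := Q.source) hF rfl)
    (fun f => measurable_ofReal_exp_mul (measurable_sum_range_comp
      (measurable_biSup_of_mem (m := Q.source) (I := {x | x.video = some f})
        (Q.measurable_source_count f s) rfl)
      fun n => Q.measurable_biSup_job (I := {x | x.video = some f}) (f := f) (n := n) j rfl
        fun v => rfl) t)
    Finset.univ
  have hl : ∀ ω, F ω * ENNReal.ofReal (Real.exp (t * Q.work j s ω)) = F ω *
      ∏ f, ENNReal.ofReal (Real.exp (t * ∑ n ∈ Finset.range (Q.count f s ω), Q.job f n j ω)) := by
    intro ω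
    rw [work_eq, Finset.mul_sum, Real.exp_sum,
      ENNReal.ofReal_prod_of_nonneg fun _ _ => Real.exp_nonneg _]
  rw [lintegral_congr hl, hprod, Finset.prod_congr rfl fun f _ => Q.lintegral_exp_stream f j s ht,
    ← ENNReal.ofReal_prod_of_nonneg fun _ _ => Real.exp_nonneg _, ← Real.exp_sum, ← Finset.mul_sum]
  rfl

theorem lintegral_exp_work (j : Fin m) (s : ℝ≥0) {t : ℝ} (ht : t < S.α j) :
    ∫⁻ ω, ENNReal.ofReal (Real.exp (t * Q.work j s ω)) ∂P
      = ENNReal.ofReal (Real.exp (s * S.phi j t)) := by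
  simpa using Q.lintegral_mul_exp_work j s ht (F := fun _ => 1)
    measurable_const

end SteadyStore

/-! ### Pathwise bounds for a unit-rate queue. -/

/-- If the queue is empty at some `u < h`, only work arriving after `u` can be left at `h`. If it is
never empty before `h`, the server is busy for the full time `h`. -/
theorem backlog_le_of_dynamics {b A : ℝ≥0 → ℝ} (hA : Monotone A)
    (hb : ∀ s, 0 ≤ b s ∧ b s = b 0 + A s
      - volume.real {u : ℝ | 0 ≤ u ∧ u < s ∧ 0 < b u.toNNReal}) (h : ℝ≥0) :
    b h ≤ max (b 0 - h) 0 + A h := by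
  -- This comes from the dynamics at time `0`; with monotonicity it gives `A u ≥ 0`.
  have h0 : A 0 = 0 := by
    have := (hb 0).2
    have hem : {u : ℝ | 0 ≤ u ∧ u < ((0 : ℝ≥0) : ℝ) ∧ 0 < b u.toNNReal} = ∅ := by
      ext u; simp only [Set.mem_ofPred_eq, Set.mem_empty_iff_false, iff_false, NNReal.coe_zero]
      rintro ⟨h1, h2, -⟩; linarith
    rw [hem] at this
    simp only [measureReal_empty] at this
    linarith
  by_cases hidle : ∃ u < h, b u = 0
  · obtain ⟨u, huh, hu⟩ := hidle
    have hmono : volume.real {v : ℝ | 0 ≤ v ∧ v < u ∧ 0 < b v.toNNReal}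
        ≤ volume.real {v : ℝ | 0 ≤ v ∧ v < h ∧ 0 < b v.toNNReal} := by
      refine measureReal_mono (fun v hv => ⟨hv.1, hv.2.1.trans (by exact_mod_cast huh), hv.2.2⟩) ?_
      refine ne_top_of_le_ne_top (measure_Ico_lt_top (μ := volume) (a := (0 : ℝ)) (b := h)).ne ?_
      exact measure_mono fun v hv => ⟨hv.1, hv.2.1⟩
    have h1 := (hb u).2
    have h2 := (hb h).2
    have h3 := hA (zero_le : 0 ≤ u)
    have h4 := le_max_right (b 0 - h) 0
    linarith
  · push Not at hidle
    have hfull : {v : ℝ | 0 ≤ v ∧ v < h ∧ 0 < b v.toNNReal} = Set.Ico 0 (h : ℝ) := by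
      ext v
      simp only [Set.mem_ofPred_eq, Set.mem_Ico]
      refine ⟨fun hv => ⟨hv.1, hv.2.1⟩, fun hv => ⟨hv.1, hv.2, ?_⟩⟩
      have : v.toNNReal < h := (Real.toNNReal_lt_iff_lt_coe hv.1).2 hv.2
      exact lt_of_le_of_ne (hb _).1 (hidle _ this).symm
    have h1 := (hb h).2
    rw [hfull, Real.volume_real_Ico_of_le h.coe_nonneg, sub_zero] at h1
    have h4 := le_max_left (b 0 - h) 0
    linarith

/-- The busy time within `[0, h)` is at most `h`. -/
theorem le_backlog_of_dynamics {b A : ℝ≥0 → ℝ}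
    (hb : ∀ s, 0 ≤ b s ∧ b s = b 0 + A s
      - volume.real {u : ℝ | 0 ≤ u ∧ u < s ∧ 0 < b u.toNNReal}) (h : ℝ≥0) :
    b 0 + A h ≤ b h + h := by
  have hle : volume.real {v : ℝ | 0 ≤ v ∧ v < h ∧ 0 < b v.toNNReal} ≤ volume.real (Set.Ico 0 (h :
      ℝ)) :=
    measureReal_mono (fun v hv => ⟨hv.1, hv.2.1⟩) measure_Ico_lt_top.ne
  rw [Real.volume_real_Ico_of_le h.coe_nonneg, sub_zero] at hle
  have := (hb h).2
  linarith

/-- For `w > h` this is an equality. For `w ≤ h` the left side is `1`, and the correction term,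
which later produces the idle probability, suffices because `exp (t * w) ≥ 1`. -/
theorem exp_max_sub_le {t h w : ℝ} (ht : 0 ≤ t) (hh : 0 ≤ h) (hw : 0 ≤ w) :
    Real.exp (t * max (w - h) 0)
      ≤ Real.exp (-(t * h)) * Real.exp (t * w) + (1 - Real.exp (-(t * h))) * (Set.Iic h).indicator
          1 w := by
  have h1 : Real.exp (-(t * h)) ≤ 1 := Real.exp_le_one_iff.2 (by nlinarith)
  by_cases hwh : w ≤ h
  · have h2 : 1 ≤ Real.exp (t * w) := Real.one_le_exp (by positivity)
    rw [max_eq_right (by linarith)]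
    simp only [mul_zero, Real.exp_zero, Set.indicator, Set.mem_Iic, hwh, if_true, Pi.one_apply]
    nlinarith [Real.exp_pos (-(t * h))]
  · rw [max_eq_left (by linarith), ← Real.exp_add]
    simp only [Set.indicator, Set.mem_Iic, hwh, if_false, mul_zero, add_zero]
    exact Real.exp_le_exp.2 (by linarith)

/-! ### The Pollaczek–Khinchine bound from stationarity. -/

namespace SteadyStore

variable {r m : ℕ} {S : Params r m} {Ω : Type*} [mΩ : MeasurableSpace Ω] {P : Measure Ω}
  (Q : SteadyStore S P)

theorem ae_monotone_work : ∀ᵐ ω ∂P, ∀ j, Monotone fun s => Q.work j s ω := by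
  filter_upwards [Q.ae_job_nonneg] with ω hω j s u hsu
  simp only [work_eq]
  refine Finset.sum_le_sum fun f _ => ?_
  exact Finset.sum_le_sum_of_subset_of_nonneg
    (Finset.range_subset_range.2 ((Q.poisson f).mono ω hsu)) fun n _ _ => hω f n j

theorem ae_backlog_nonneg : ∀ᵐ ω ∂P, ∀ j s, 0 ≤ Q.backlog j s ω := by
  filter_upwards [Q.dynamics] with ω hω j s using (hω j s).1

theorem ae_work_nonneg : ∀ᵐ ω ∂P, ∀ j s, 0 ≤ Q.work j s ω := by
  filter_upwards [Q.ae_job_nonneg] with ω hω j s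
  rw [work_eq]
  exact Finset.sum_nonneg fun f _ => Finset.sum_nonneg fun n _ => hω f n j

theorem ae_backlog_le : ∀ᵐ ω ∂P, ∀ j s,
    Q.backlog j s ω ≤ max (Q.backlog j 0 ω - s) 0 + Q.work j s ω := by
  filter_upwards [Q.dynamics, Q.ae_monotone_work] with ω hω hmono j s
  exact backlog_le_of_dynamics (b := fun s => Q.backlog j s ω) (hmono j) (hω j) s

theorem ae_le_backlog : ∀ᵐ ω ∂P, ∀ j s,
    Q.backlog j 0 ω + Q.work j s ω ≤ Q.backlog j s ω + s := by
  filter_upwards [Q.dynamics] with ω hω j s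
  exact le_backlog_of_dynamics (b := fun s => Q.backlog j s ω) (A := fun s => Q.work j s ω) (hω j) s

theorem lintegral_backlog_eq (j : Fin m) (s : ℝ≥0) {F : ℝ → ℝ≥0∞} (hF : Measurable F) :
    ∫⁻ ω, F (Q.backlog j s ω) ∂P = ∫⁻ ω, F (Q.backlog j 0 ω) ∂P :=
  ((Q.steady s).comp (u := fun w : Fin m → ℝ => F (w j)) (by fun_prop)).lintegral_eq

variable [IsProbabilityMeasure P]

/-- The truncation at level `c` makes all terms finite without any assumption on the moments. -/
theorem lintegral_truncated_exp_backlog_le (j : Fin m) {t : ℝ} (ht : 0 < t) (htα : t < S.α j)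
    (h : ℝ≥0) (c : ℝ) :
    ∫⁻ ω, (Set.Iic c).indicator (fun w => ENNReal.ofReal (Real.exp (t * w))) (Q.backlog j 0 ω) ∂P
      ≤ (∫⁻ ω, (Set.Iic c).indicator (fun w => ENNReal.ofReal (Real.exp (t * max (w - h) 0)))
          (Q.backlog j 0 ω) ∂P) * ENNReal.ofReal (Real.exp (h * S.phi j t)) := by
  have hmc : MeasurableSet (Set.Iic c) := measurableSet_Iic
  have hmc' : MeasurableSet (Set.Iic c)ᶜ := hmc.compl
  set K : ℝ≥0∞ := ENNReal.ofReal (Real.exp (t * c)) with hK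
  set V : ℝ → ℝ≥0∞ := fun w => ENNReal.ofReal (Real.exp (t * w)) with hV
  set V' : ℝ → ℝ≥0∞ := fun w => ENNReal.ofReal (Real.exp (t * max (w - h) 0)) with hV'
  have hVm : Measurable V := by fun_prop
  have hVm' : Measurable V' := by fun_prop
  have hb : Measurable (Q.backlog j 0) := Q.backlog_measurable j 0
  -- Capping at `K = exp (t * c)` turns the part above level `c` into a finite constant mass. That
  -- mass appears on both sides of the stationarity comparison and cancels.
  have hsplit : ∀ w, min (V w) K = (Set.Iic c).indicator V w + (Set.Iic c)ᶜ.indicator (fun _ => K)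
      w := by
    intro w
    by_cases hw : w ≤ c
    · have : V w ≤ K := ENNReal.ofReal_le_ofReal (Real.exp_le_exp.2 (by nlinarith))
      simp [hw, this]
    · have : K ≤ V w := ENNReal.ofReal_le_ofReal (Real.exp_le_exp.2 (by nlinarith))
      simp [hw, not_le.1 hw, this]
  have hstep : ∫⁻ ω, min (V (Q.backlog j h ω)) K ∂P
      ≤ ∫⁻ ω, (Set.Iic c).indicator V' (Q.backlog j 0 ω)
          * ENNReal.ofReal (Real.exp (t * Q.work j h ω))
          + (Set.Iic c)ᶜ.indicator (fun _ => K) (Q.backlog j 0 ω) ∂P := by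
    refine lintegral_mono_ae ?_
    filter_upwards [Q.ae_backlog_le] with ω hω
    by_cases hw : Q.backlog j 0 ω ≤ c
    · refine (min_le_left _ _).trans ?_
      simp only [Set.indicator, Set.mem_Iic, hw, if_true, Set.mem_compl_iff, not_true,
        if_false, add_zero, hV, hV']
      rw [← ENNReal.ofReal_mul (Real.exp_nonneg _), ← Real.exp_add, ← mul_add]
      exact ENNReal.ofReal_le_ofReal (Real.exp_le_exp.2 (mul_le_mul_of_nonneg_left (hω j h) ht.le))
    · simp [hw, not_le.1 hw]
  have hfac := Q.lintegral_mul_exp_work j h htα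
    (F := fun ω => (Set.Iic c).indicator V' (Q.backlog j 0 ω))
    ((hVm'.indicator hmc).comp (Q.measurable_source_backlog j))
  have hm1 : Measurable fun ω => (Set.Iic c)ᶜ.indicator (fun _ => K) (Q.backlog j 0 ω) :=
    (measurable_const.indicator hmc').comp hb
  have hm2 : Measurable fun ω => (Set.Iic c).indicator V (Q.backlog j 0 ω) :=
    (hVm.indicator hmc).comp hb
  rw [Q.lintegral_backlog_eq j h (F := fun w => min (V w) K) (by fun_prop),
    lintegral_congr fun ω => hsplit (Q.backlog j 0 ω), lintegral_add_right _ hm1,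
    lintegral_add_right _ hm1, hfac] at hstep
  refine ENNReal.le_of_add_le_add_right ?_ hstep
  refine ne_top_of_le_ne_top (ENNReal.ofReal_ne_top : K ≠ ⊤) ?_
  calc ∫⁻ ω, (Set.Iic c)ᶜ.indicator (fun _ => K) (Q.backlog j 0 ω) ∂P ≤ ∫⁻ _, K ∂P :=
        lintegral_mono fun ω => Set.indicator_le_self (Set.Iic c)ᶜ (fun _ => K) (Q.backlog j 0 ω)
    _ = K := by simp

/-- A truncated moment `x` satisfies `x ≤ (e x + (1 - e) p) g`. Since `e g < 1`, this can be solved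
for `x`, with a bound independent of the truncation level. -/
theorem lintegral_exp_backlog_le_of_pos (j : Fin m) {t : ℝ} (ht : 0 < t) (htα : t < S.α j)
    (hφ : S.phi j t < t) {h : ℝ≥0} (hh : 0 < h) :
    ∫⁻ ω, ENNReal.ofReal (Real.exp (t * Q.backlog j 0 ω)) ∂P
      ≤ ENNReal.ofReal (Real.exp (h * S.phi j t) * t * P.real {ω | Q.backlog j 0 ω ≤ h}
          * (1 + h * (t - S.phi j t)) / (t - S.phi j t)) := by
  have hh' : (0 : ℝ) < h := hh
  have hb : Measurable (Q.backlog j 0) := Q.backlog_measurable j 0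
  set g := Real.exp (h * S.phi j t) with hg
  set e := Real.exp (-(t * h)) with he
  set p := P.real {ω | Q.backlog j 0 ω ≤ h} with hp
  set C := g * t * p * (1 + h * (t - S.phi j t)) / (t - S.phi j t) with hC
  have he1 : e ≤ 1 := Real.exp_le_one_iff.2 (by nlinarith)
  have hmh : MeasurableSet {ω | Q.backlog j 0 ω ≤ h} := hb measurableSet_Iic
  have htrunc : ∀ n : ℕ, ∫⁻ ω, (Set.Iic (n : ℝ)).indicator
      (fun w => ENNReal.ofReal (Real.exp (t * w))) (Q.backlog j 0 ω) ∂P ≤ ENNReal.ofReal C := by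
    intro n
    set x := ∫⁻ ω, (Set.Iic (n : ℝ)).indicator
      (fun w => ENNReal.ofReal (Real.exp (t * w))) (Q.backlog j 0 ω) ∂P with hx
    have hxfin : x ≠ ⊤ := by
      refine ne_top_of_le_ne_top (ENNReal.ofReal_ne_top (r := Real.exp (t * n))) ?_
      calc x ≤ ∫⁻ _, ENNReal.ofReal (Real.exp (t * n)) ∂P := by
            refine lintegral_mono fun ω => ?_
            by_cases hw : Q.backlog j 0 ω ≤ n
            · simp only [Set.indicator, Set.mem_Iic, hw, if_true]
              exact ENNReal.ofReal_le_ofReal (Real.exp_le_exp.2 (by nlinarith))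
            · simp [hw]
        _ = _ := by simp
    have hstep : ∫⁻ ω, (Set.Iic (n : ℝ)).indicator
        (fun w => ENNReal.ofReal (Real.exp (t * max (w - h) 0))) (Q.backlog j 0 ω) ∂P
        ≤ ENNReal.ofReal e * x + ENNReal.ofReal (1 - e) * P {ω | Q.backlog j 0 ω ≤ h} := by
      have hm : Measurable fun ω => (Set.Iic (n : ℝ)).indicator
          (fun w => ENNReal.ofReal (Real.exp (t * w))) (Q.backlog j 0 ω) :=
        (Measurable.indicator (by fun_prop) measurableSet_Iic).comp hb
      rw [hx, ← lintegral_const_mul _ hm, ← lintegral_indicator_one hmh,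
        ← lintegral_const_mul _ (measurable_indicator_one hmh),
        ← lintegral_add_left (hm.const_mul _)]
      refine lintegral_mono_ae ?_
      filter_upwards [Q.ae_backlog_nonneg] with ω hω
      by_cases hw : Q.backlog j 0 ω ≤ n
      · have hnn : 0 ≤ (1 - Real.exp (-(t * h))) * (Set.Iic (h : ℝ)).indicator 1 (Q.backlog j 0 ω)
          :=
          mul_nonneg (sub_nonneg.2 he1) (Set.indicator_nonneg (fun _ _ => zero_le_one) _)
        have := ENNReal.ofReal_le_ofReal (exp_max_sub_le ht.le hh'.le (hω j 0))
        rw [ENNReal.ofReal_add (by positivity) hnn,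
          ENNReal.ofReal_mul (by positivity), ENNReal.ofReal_mul (sub_nonneg.2 he1)] at this
        rw [Set.indicator_of_mem (Set.mem_Iic.2 hw), Set.indicator_of_mem (Set.mem_Iic.2 hw)]
        refine this.trans (le_of_eq ?_)
        congr 2
        by_cases hwh : Q.backlog j 0 ω ≤ h <;> simp [hwh]
      · simp [hw]
    have hxr := ENNReal.toReal_mono (by finiteness)
      ((Q.lintegral_truncated_exp_backlog_le j ht htα h n).trans (mul_le_mul_left hstep _))
    rw [ENNReal.toReal_mul, ENNReal.toReal_add (by finiteness) (by finiteness), ENNReal.toReal_mul,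
      ENNReal.toReal_mul, ENNReal.toReal_ofReal (Real.exp_nonneg _),
      ENNReal.toReal_ofReal (Real.exp_nonneg _), ENNReal.toReal_ofReal (by linarith)] at hxr
    change x.toReal ≤ (e * x.toReal + (1 - e) * p) * g at hxr
    rw [← ENNReal.ofReal_toReal hxfin]
    refine ENNReal.ofReal_le_ofReal ?_
    have hp0 : 0 ≤ p := measureReal_nonneg
    have hx0 : 0 ≤ x.toReal := ENNReal.toReal_nonneg
    set y := h * (t - S.phi j t) with hy
    have hy0 : 0 < y := mul_pos hh' (by linarith)
    have hg0 : 0 < g := Real.exp_pos _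
    -- Here `e * g = exp (-y)`, so `(1 - e * g) * (1 + y) ≥ y`. This replaces the exact denominator
    -- `1 - e * g` by one linear in `h`.
    have heg : e * g * (1 + y) ≤ 1 := by
      have h1 : e * g = Real.exp (-y) := by rw [he, hg, ← Real.exp_add]; congr 1; rw [hy]; ring
      rw [h1, Real.exp_neg, inv_mul_le_iff₀ (Real.exp_pos _), mul_one]
      linarith [Real.add_one_le_exp y]
    have h1e : 1 - e ≤ t * h := by
      have := Real.add_one_le_exp (-(t * h))
      linarith
    have hmain : x.toReal * (h * (t - S.phi j t)) ≤ g * t * p * (1 + y) * h := by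
      have h2 : x.toReal * (1 - e * g) ≤ (t * h) * p * g := by
        have : (1 - e) * p * g ≤ (t * h) * p * g := by gcongr
        linarith
      have h3 : x.toReal * ((1 - e * g) * (1 + y)) ≤ (t * h) * p * g * (1 + y) := by
        rw [← mul_assoc]; gcongr
      have h4 : x.toReal * y ≤ x.toReal * ((1 - e * g) * (1 + y)) := by
        gcongr; linarith
      linarith
    rw [hC, le_div_iff₀ (by linarith)]
    refine le_of_mul_le_mul_right ?_ hh'
    linarith
  -- Monotone convergence removes the truncation.
  have hmono : Monotone fun (n : ℕ) ω => (Set.Iic (n : ℝ)).indicator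
      (fun w => ENNReal.ofReal (Real.exp (t * w))) (Q.backlog j 0 ω) := by
    intro a b hab ω
    exact Set.indicator_le_indicator_of_subset (Set.Iic_subset_Iic.2 (Nat.cast_le.2 hab))
      (fun _ => zero_le) _
  have hsup : ∀ ω, ENNReal.ofReal (Real.exp (t * Q.backlog j 0 ω))
      ≤ ⨆ n : ℕ, (Set.Iic (n : ℝ)).indicator
      (fun w => ENNReal.ofReal (Real.exp (t * w))) (Q.backlog j 0 ω) := by
    intro ω
    obtain ⟨n, hn⟩ := exists_nat_ge (Q.backlog j 0 ω)
    refine le_iSup_of_le n ?_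
    simp [hn]
  refine (lintegral_mono hsup).trans ?_
  have hmeas : ∀ n : ℕ, Measurable fun ω => (Set.Iic (n : ℝ)).indicator
      (fun w => ENNReal.ofReal (Real.exp (t * w))) (Q.backlog j 0 ω) := fun n =>
    (Measurable.indicator (by fun_prop) measurableSet_Iic).comp hb
  rw [lintegral_iSup hmeas hmono]
  exact iSup_le htrunc

/-- Limit `h → 0+` of the preceding bound; the distribution function of the backlog is
right-continuous at `0`. -/
theorem lintegral_exp_backlog_le_mul_idle (j : Fin m) {t : ℝ} (ht : 0 < t) (htα : t < S.α j)
    (hφ : S.phi j t < t) :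
    ∫⁻ ω, ENNReal.ofReal (Real.exp (t * Q.backlog j 0 ω)) ∂P
      ≤ ENNReal.ofReal (t * P.real {ω | Q.backlog j 0 ω ≤ 0} / (t - S.phi j t)) := by
  have hb : Measurable (Q.backlog j 0) := Q.backlog_measurable j 0
  have hp : Tendsto (fun h : ℝ => P.real {ω | Q.backlog j 0 ω ≤ h}) (𝓝[>] 0)
      (𝓝 (P.real {ω | Q.backlog j 0 ω ≤ 0})) := by
    have h1 := tendsto_measure_biInter_gt (μ := P) (s := fun h : ℝ => {ω | Q.backlog j 0 ω ≤ h})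
      (a := 0) (fun h _ => (hb measurableSet_Iic).nullMeasurableSet)
      (fun a b _ hab ω hω => le_trans hω hab) ⟨1, one_pos, measure_ne_top _ _⟩
    have h2 : (⋂ h : ℝ, ⋂ (_ : h > 0), {ω | Q.backlog j 0 ω ≤ h}) = {ω | Q.backlog j 0 ω ≤ 0} := by
      ext ω
      simp only [Set.mem_iInter, Set.mem_ofPred_eq]
      exact ⟨fun H => le_of_forall_gt_imp_ge_of_dense H, fun H h hh => H.trans hh.le⟩
    rw [h2] at h1
    exact (ENNReal.tendsto_toReal (measure_ne_top _ _)).comp h1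
  have hid : Tendsto (fun h : ℝ => h) (𝓝[>] 0) (𝓝 0) := tendsto_nhdsWithin_of_tendsto_nhds
      tendsto_id
  have hlim : Tendsto (fun h : ℝ => Real.exp (h * S.phi j t) * t * P.real {ω | Q.backlog j 0 ω ≤ h}
          * (1 + h * (t - S.phi j t)) / (t - S.phi j t)) (𝓝[>] 0)
      (𝓝 (Real.exp (0 * S.phi j t) * t * P.real {ω | Q.backlog j 0 ω ≤ 0}
          * (1 + 0 * (t - S.phi j t)) / (t - S.phi j t))) :=
    (((((Real.continuous_exp.tendsto _).comp (hid.mul_const _)).mul_const t).mul hp).mul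
      ((hid.mul_const _).const_add 1)).div_const _
  simp only [zero_mul, Real.exp_zero, one_mul, add_zero, mul_one] at hlim
  refine ge_of_tendsto (ENNReal.tendsto_ofReal hlim) ?_
  filter_upwards [self_mem_nhdsWithin] with h hh
  exact Q.lintegral_exp_backlog_le_of_pos j ht htα hφ (h := ⟨h, le_of_lt hh⟩) hh

/-- Finiteness of the mean backlog permits its cancellation in the work balance of
`lintegral_work_le`. -/
theorem lintegral_backlog_ne_top (j : Fin m) {t : ℝ} (ht : 0 < t) (htα : t < S.α j)
    (hφ : S.phi j t < t) : ∫⁻ ω, ENNReal.ofReal (Q.backlog j 0 ω) ∂P ≠ ⊤ := by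
  have h1 : ∫⁻ ω, ENNReal.ofReal (1 / t) * ENNReal.ofReal (Real.exp (t * Q.backlog j 0 ω)) ∂P ≠ ⊤
      := by
    rw [lintegral_const_mul _ (measurable_ofReal_exp_mul (Q.backlog_measurable j 0) t)]
    exact ENNReal.mul_ne_top ENNReal.ofReal_ne_top
      (ne_top_of_le_ne_top ENNReal.ofReal_ne_top (Q.lintegral_exp_backlog_le_mul_idle j ht htα hφ))
  refine ne_top_of_le_ne_top h1 (lintegral_mono fun ω => ?_)
  rw [← ENNReal.ofReal_mul (by positivity)]
  refine ENNReal.ofReal_le_ofReal ?_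
  rw [one_div, ← div_eq_inv_mul, le_div_iff₀ ht]
  linarith [Real.add_one_le_exp (t * Q.backlog j 0 ω)]

theorem measure_count_ne_zero (f : Fin r) (h : ℝ≥0) :
    P {ω | Q.count f h ω ≠ 0} = ENNReal.ofReal (1 - Real.exp (-(S.lam f * h))) := by
  have h0 : MeasurableSet {ω | Q.count f h ω = 0} :=
    (Q.poisson f).measurable h (measurableSet_singleton 0)
  have h1 : P {ω | Q.count f h ω = 0} = ENNReal.ofReal (Real.exp (-(S.lam f * h))) := by
    rw [(Q.hasLaw_count f h).measure_eq (p := fun k => k = 0) (measurableSet_singleton 0)]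
    have := poissonMeasure_singleton (S.lam f * h) 0
    simpa using this
  have h2 := prob_compl_eq_one_sub (μ := P) h0
  rw [h1, ← ENNReal.ofReal_one, ← ENNReal.ofReal_sub _ (Real.exp_nonneg _)] at h2
  exact h2

/-- Work balance: stationarity makes the mean backlogs at `0` and `h` equal, so the arriving work is
at most the work served. Service can matter only on the event `G` that the server starts busy or a
request arrives by `h`; off `G`, both the initial backlog and the arriving work vanish. -/
theorem lintegral_work_le (j : Fin m) {t : ℝ} (ht : 0 < t) (htα : t < S.α j)
    (hφ : S.phi j t < t) (h : ℝ≥0) :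
    ∫⁻ ω, ENNReal.ofReal (Q.work j h ω) ∂P
      ≤ h * (P {ω | 0 < Q.backlog j 0 ω}
        + ∑ f, ENNReal.ofReal (1 - Real.exp (-(S.lam f * h)))) := by
  classical
  set G : Set Ω := {ω | 0 < Q.backlog j 0 ω} ∪ ⋃ f ∈ Finset.univ, {ω | Q.count f h ω ≠ 0} with hGdef
  have hG : MeasurableSet G := by
    refine (Q.backlog_measurable j 0 measurableSet_Ioi).union ?_
    refine Finset.measurableSet_biUnion _ fun f _ => ?_
    exact ((Q.poisson f).measurable h (measurableSet_singleton 0)).compl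
  have hPG : P G ≤ P {ω | 0 < Q.backlog j 0 ω}
        + ∑ f, ENNReal.ofReal (1 - Real.exp (-(S.lam f * h))) := by
    refine (measure_union_le _ _).trans (add_le_add le_rfl ?_)
    refine (measure_biUnion_finset_le _ _).trans (le_of_eq ?_)
    exact Finset.sum_congr rfl fun f _ => Q.measure_count_ne_zero f h
  refine le_trans ?_ (mul_le_mul_right hPG _)
  have hpt : ∫⁻ ω, ENNReal.ofReal (Q.backlog j 0 ω) + ENNReal.ofReal (Q.work j h ω) ∂P
      ≤ ∫⁻ ω, ENNReal.ofReal (Q.backlog j h ω) + h * G.indicator 1 ω ∂P := by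
    refine lintegral_mono_ae ?_
    filter_upwards [Q.ae_le_backlog, Q.ae_backlog_nonneg, Q.ae_work_nonneg] with ω h1 h2 h3
    by_cases hω : ω ∈ G
    · rw [Set.indicator_of_mem hω, Pi.one_apply, mul_one, ← ENNReal.ofReal_add (h2 j 0) (h3 j h),
        ← ENNReal.ofReal_coe_nnreal, ← ENNReal.ofReal_add (h2 j h) h.coe_nonneg]
      exact ENNReal.ofReal_le_ofReal (h1 j h)
    · simp only [hGdef, Set.mem_union, Set.mem_ofPred_eq, Set.mem_iUnion, Finset.mem_univ,
        not_or, not_lt, not_exists, true_and, exists_prop, not_not, ne_eq] at hω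
      have hw : Q.work j h ω = 0 := by
        rw [work_eq]
        exact Finset.sum_eq_zero fun f _ => by rw [hω.2 f]; simp
      simp [ENNReal.ofReal_of_nonpos hω.1, hw]
  have hm : Measurable fun ω => ENNReal.ofReal (Q.backlog j 0 ω) := (Q.backlog_measurable j
      0).ennreal_ofReal
  have hm' : Measurable fun ω => ENNReal.ofReal (Q.backlog j h ω) := (Q.backlog_measurable j
      h).ennreal_ofReal
  rw [lintegral_add_left hm, lintegral_add_left hm',
    Q.lintegral_backlog_eq j h ENNReal.measurable_ofReal,
    lintegral_const_mul _ (measurable_indicator_one hG), lintegral_indicator_one hG] at hpt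
  exact ENNReal.le_of_add_le_add_left (Q.lintegral_backlog_ne_top j ht htα hφ) hpt

theorem rho_le_add (j : Fin m) {t : ℝ} (ht : 0 < t) (htα : t < S.α j)
    (hφ : S.phi j t < t) {h : ℝ≥0} (hh : 0 < h) :
    S.rho j ≤ P.real {ω | 0 < Q.backlog j 0 ω} + ∑ f, (1 - Real.exp (-(S.lam f * h))) := by
  have hh' : (0 : ℝ) < h := hh
  set q := P.real {ω | 0 < Q.backlog j 0 ω} + ∑ f, (1 - Real.exp (-(S.lam f * h))) with hq
  have h1e : ∀ f, 0 ≤ 1 - Real.exp (-(S.lam f * h : ℝ)) := fun f => by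
    have : Real.exp (-(S.lam f * h : ℝ)) ≤ 1 := Real.exp_le_one_iff.2 (by
      have := mul_nonneg (S.lam f).2 h.2
      simpa using this)
    linarith
  have hq0 : 0 ≤ q := add_nonneg measureReal_nonneg (Finset.sum_nonneg fun f _ => h1e f)
  have hqe : P {ω | 0 < Q.backlog j 0 ω} + ∑ f, ENNReal.ofReal (1 - Real.exp (-(S.lam f * h)))
      = ENNReal.ofReal q := by
    rw [hq, ENNReal.ofReal_add measureReal_nonneg (Finset.sum_nonneg fun f _ => h1e f),
      ENNReal.ofReal_sum_of_nonneg fun f _ => h1e f, ofReal_measureReal]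
  -- The inequality `1 ≤ exp (-x) + x` is averaged at `x = u * work`, which trades the mean of the
  -- work for its known transform.
  have hge : ∀ u : ℝ, 0 < u → 1 ≤ Real.exp (h * S.phi j (-u)) + u * (h * q) := by
    intro u hu
    have h1 : (1 : ℝ≥0∞) ≤ ∫⁻ ω, ENNReal.ofReal (Real.exp (-u * Q.work j h ω))
        + ENNReal.ofReal u * ENNReal.ofReal (Q.work j h ω) ∂P := by
      calc (1 : ℝ≥0∞) = ∫⁻ _, 1 ∂P := by simp
        _ ≤ _ := lintegral_mono_ae ?_
      filter_upwards [Q.ae_work_nonneg] with ω hω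
      rw [← ENNReal.ofReal_mul hu.le, ← ENNReal.ofReal_add (Real.exp_nonneg _)
        (mul_nonneg hu.le (hω j h)), ← ENNReal.ofReal_one]
      refine ENNReal.ofReal_le_ofReal ?_
      linarith [Real.add_one_le_exp (-u * Q.work j h ω)]
    rw [lintegral_add_left (measurable_ofReal_exp_mul (Q.measurable_work j h) _),
      lintegral_const_mul _ (Q.measurable_work j h).ennreal_ofReal,
      Q.lintegral_exp_work j h (by linarith [S.α_pos j])] at h1
    have h2 := h1.trans (add_le_add le_rfl
      (mul_le_mul_right (Q.lintegral_work_le j ht htα hφ h) (ENNReal.ofReal u)))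
    rw [hqe, ← ENNReal.ofReal_coe_nnreal, ← ENNReal.ofReal_mul h.coe_nonneg, ← ENNReal.ofReal_mul
        hu.le,
      ← ENNReal.ofReal_add (Real.exp_nonneg _) (by positivity), ENNReal.one_le_ofReal] at h2
    exact h2
  have hd : HasDerivAt (fun u => Real.exp (h * S.phi j (-u)) + u * (h * q))
      (h * (-S.rho j) + h * q) 0 := by
    have h1 : HasDerivAt (fun u => S.phi j (-u)) (-S.rho j) 0 := by
      have := HasDerivAt.scomp (0 : ℝ) (h := fun u : ℝ => -u) (h' := -1) (g₁ := S.phi j)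
        (g₁' := S.rho j) (by simpa using S.hasDerivAt_phi_zero j) (hasDerivAt_neg 0)
      simpa [Function.comp_def] using this
    have h2 := ((h1.const_mul (h : ℝ)).exp).add ((hasDerivAt_id (0 : ℝ)).mul_const (h * q))
    refine h2.congr_deriv ?_
    simp [S.phi_zero]
  have hs := hd.tendsto_slope_zero_right
  -- The right side of `hge` equals `1` at `u = 0`, so its right derivative there is nonnegative.
  have hnn : 0 ≤ h * (-S.rho j) + h * q := by
    refine ge_of_tendsto hs ?_
    filter_upwards [self_mem_nhdsWithin] with u hu
    have := hge u hu
    simp only [zero_add, neg_zero, S.phi_zero, mul_zero, Real.exp_zero, zero_mul, add_zero,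
        smul_eq_mul]
    exact mul_nonneg (inv_nonneg.2 (le_of_lt hu)) (by linarith)
  refine le_of_mul_le_mul_left ?_ hh'
  linarith

/-- As `h → 0`, the probability of an arrival in the interval vanishes. -/
theorem rho_le_measure_busy (j : Fin m) {t : ℝ} (ht : 0 < t) (htα : t < S.α j)
    (hφ : S.phi j t < t) : S.rho j ≤ P.real {ω | 0 < Q.backlog j 0 ω} := by
  have hc : Continuous fun h : ℝ =>
      P.real {ω | 0 < Q.backlog j 0 ω} + ∑ f, (1 - Real.exp (-(S.lam f * h))) := by fun_prop
  have hlim := (hc.tendsto 0).mono_left (nhdsWithin_le_nhds (s := Set.Ioi 0))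
  simp only [mul_zero, neg_zero, Real.exp_zero, sub_self, Finset.sum_const_zero, add_zero] at hlim
  refine ge_of_tendsto hlim ?_
  filter_upwards [self_mem_nhdsWithin] with h hh
  exact Q.rho_le_add j ht htα hφ (h := ⟨h, le_of_lt hh⟩) hh

/-- The Pollaczek–Khinchine bound for the exponential moments of the backlog. -/
theorem lintegral_exp_backlog_le (j : Fin m) (s : ℝ≥0) {t : ℝ} (ht : 0 < t) (htα : t < S.α j)
    (hφ : S.phi j t < t) :
    ∫⁻ ω, ENNReal.ofReal (Real.exp (t * Q.backlog j s ω)) ∂P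
      ≤ ENNReal.ofReal ((1 - S.rho j) * t / (t - S.phi j t)) := by
  rw [Q.lintegral_backlog_eq j s (F := fun w => ENNReal.ofReal (Real.exp (t * w))) (by fun_prop)]
  refine (Q.lintegral_exp_backlog_le_mul_idle j ht htα hφ).trans (ENNReal.ofReal_le_ofReal ?_)
  have h1 : P.real {ω | Q.backlog j 0 ω ≤ 0} = 1 - P.real {ω | 0 < Q.backlog j 0 ω} := by
    have hm : MeasurableSet {ω | 0 < Q.backlog j 0 ω} := Q.backlog_measurable j 0 measurableSet_Ioi
    rw [← probReal_compl_eq_one_sub hm]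
    congr 1
    ext ω; simp
  have h2 := Q.rho_le_measure_busy j ht htα hφ
  have h3 : 0 < t - S.phi j t := by linarith
  rw [mul_comm (1 - S.rho j)]
  gcongr
  linarith

end SteadyStore

/-! ### Comparison with the closed form `H`. -/

namespace Params

variable {r m : ℕ} (S : Params r m)

theorem one_le_M {j : Fin m} {t : ℝ} (ht : 0 ≤ t) (htα : t < S.α j) : 1 ≤ S.M j t := by
  rw [M, one_le_div (by linarith)]
  have h1 : 1 ≤ Real.exp (S.β j * t) := Real.one_le_exp (mul_nonneg (S.β_nonneg j) ht)
  nlinarith [S.α_pos j]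

theorem geomQuot_eq_sum (x : ℝ) (n : ℕ) : geomQuot x n = ∑ p ∈ Finset.range n, x ^ p := by
  unfold geomQuot
  split_ifs with h
  · simp [h]
  · rw [geom_sum_eq h, ← neg_div_neg_eq, neg_sub, neg_sub]

theorem phi_eq (j : Fin m) (t : ℝ) :
    S.phi j t = ∑ f, S.usage f j * (S.lam f : ℝ) * S.M j t ^ S.L f - S.Lam j := by
  rw [phi, Lam, ← Finset.sum_sub_distrib]
  exact Finset.sum_congr rfl fun f _ => by ring

/-- Servers with positive weight in the final sum have positive traffic, so the division by `Lam`
inside `B` is genuine there. -/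
theorem Lam_pos {i : Fin r} {j : Fin m} (h : 0 < S.usage i j) : 0 < S.Lam j :=
  Finset.sum_pos' (fun f _ => mul_nonneg (S.lam f).coe_nonneg (S.usage_nonneg f j))
    ⟨i, Finset.mem_univ i, mul_pos (NNReal.coe_pos.2 (S.lam_pos i)) h⟩

theorem Lam_mul_B_sub_one {j : Fin m} (h : 0 < S.Lam j) (t : ℝ) :
    S.Lam j * (S.B j t - 1) = S.phi j t := by
  rw [phi_eq, mul_sub, mul_one, B, Finset.mul_sum]
  congr 1
  refine Finset.sum_congr rfl fun f _ => ?_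
  field_simp

theorem one_le_B {j : Fin m} (h : 0 < S.Lam j) {t : ℝ} (ht : 0 ≤ t) (htα : t < S.α j) :
    1 ≤ S.B j t := by
  have h1 : ∑ f, S.usage f j * (S.lam f : ℝ) / S.Lam j = 1 := by
    rw [← Finset.sum_div, div_eq_one_iff_eq h.ne', Lam]
    exact Finset.sum_congr rfl fun f _ => mul_comm _ _
  rw [← h1]
  refine Finset.sum_le_sum fun f _ => le_mul_of_one_le_right ?_ (one_le_pow₀ (S.one_le_M ht htα))
  exact div_nonneg (mul_nonneg (S.usage_nonneg f j) (S.lam f).coe_nonneg) h.le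

/-- `H` dominates the sum of the exponential moments of the download times of one server. -/
theorem mul_sum_le_H {i : Fin r} {j : Fin m} (h : 0 < S.Lam j) {t : ℝ} (ht : 0 < t)
    (htα : t < S.α j) (hρ : S.rho j < 1) (hφ : S.phi j t < t) :
    ∑ p ∈ Finset.range (S.L i), Real.exp (-t * (S.ds + p * S.τ))
        * ((1 - S.rho j) * t / (t - S.phi j t) * S.M j t ^ (p + 1)) ≤ S.H i j t := by
  have hB := S.one_le_B h ht.le htα
  have hMt : 0 ≤ S.Mtilde j t := mul_nonneg (S.M_nonneg htα) (Real.exp_nonneg _)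
  have hterm : ∀ p : ℕ, Real.exp (-t * (S.ds + p * S.τ))
        * ((1 - S.rho j) * t / (t - S.phi j t) * S.M j t ^ (p + 1))
      -- The factor `1` holds the place of `B`. The backlog bound produces no `B`, so `H` is larger
      -- by exactly this factor, and `1 ≤ B` closes the gap.
      = Real.exp (-t * (S.ds - S.τ)) * (1 - S.rho j) * t * 1 * S.Mtilde j t / (t - S.phi j t)
        * S.Mtilde j t ^ p := by
    intro p
    have h1 : Real.exp (-t * (S.ds + p * S.τ))
        = Real.exp (-t * (S.ds - S.τ)) * Real.exp (-t * S.τ) ^ (p + 1) := by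
      rw [← Real.exp_nat_mul, ← Real.exp_add]
      push_cast
      congr 1; ring
    rw [h1, Mtilde, mul_pow]
    ring
  rw [Finset.sum_congr rfl fun p _ => hterm p, ← Finset.mul_sum, H, S.Lam_mul_B_sub_one h,
    geomQuot_eq_sum]
  have h1 : 0 ≤ 1 - S.rho j := by linarith
  have h2 : 0 < t - S.phi j t := by linarith
  gcongr

end Params

/-! ### The stall of a single request. -/

namespace Request

variable {r m : ℕ} {S : Params r m} {Ω : Type*} [mΩ : MeasurableSpace Ω] {P : Measure Ω}
  {Q : SteadyStore S P} {i : Fin r} {s : ℝ≥0}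

/-- The σ-algebras of the independent sources of randomness of a request. -/
@[reducible]
def source (R : Request Q i s) : RequestSource m → MeasurableSpace Ω
  | .found => MeasurableSpace.comap (fun ω j => Q.backlog j s ω) inferInstance
  | .choice => MeasurableSpace.comap R.choice inferInstance
  | .chunk j v => MeasurableSpace.comap (R.chunk j v) inferInstance

variable (R : Request Q i s)

theorem iIndep_source : iIndep R.source P :=
  R.indep

theorem source_le (x : RequestSource m) : R.source x ≤ mΩ := by
  cases x with
  | found => exact (measurable_pi_lambda _ fun j => Q.backlog_measurable j s).comap_le
  | choice => exact R.choice_measurable.comap_le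
  | chunk j v => exact (R.chunk_measurable j v).comap_le

theorem measurable_source_wait (j : Fin m) : Measurable[R.source .found] (Q.backlog j s) :=
  (measurable_pi_apply j).comp (comap_measurable fun ω j => Q.backlog j s ω)

theorem measurable_download (j : Fin m) (q : ℕ) : Measurable (R.download j q) :=
  (Q.backlog_measurable j s).add
    (Finset.measurable_fun_sum (Finset.range q) fun v _ => R.chunk_measurable j v)

theorem measurable_segmentDownload (q : ℕ) : Measurable (R.segmentDownload q) := by
  -- The chosen set has finitely many values, so it suffices to treat each fixed set.
  have h : Measurable fun x : Finset (Fin m) × Ω =>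
      if h : x.1.Nonempty then x.1.sup' h fun j => R.download j q x.2 else 0 := by
    refine measurable_from_prod_countable_right fun A => ?_
    by_cases hA : A.Nonempty
    · simp only [hA, dif_pos]
      convert Finset.measurable_sup' hA fun j _ => R.measurable_download j q using 1
      ext ω
      rw [Finset.sup'_apply]
    · simp only [hA, dif_neg, not_false_eq_true]
      exact measurable_const
  exact h.comp (R.choice_measurable.prodMk measurable_id)

theorem measurable_playTime (n : ℕ) : Measurable (R.playTime (n + 1)) := by
  induction n with
  | zero => exact measurable_const.max (R.measurable_segmentDownload 1)
  | succ n ih => exact (ih.add_const _).max (R.measurable_segmentDownload (n + 2))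

theorem measurable_stall : Measurable R.stall := by
  obtain ⟨n, hn⟩ := Nat.exists_eq_add_of_le' (S.L_pos i)
  unfold stall
  rw [hn]
  exact ((R.measurable_playTime n).sub_const _).sub_const _

theorem le_playTime (n : ℕ) (ω : Ω) : S.ds + n * S.τ ≤ R.playTime (n + 1) ω := by
  induction n with
  | zero => simp [playTime]
  | succ n ih =>
    refine le_trans ?_ (le_max_left _ _)
    push_cast
    linarith

/-- Playback of the last segment is determined either by the start-up delay or by the most recent
segment `p + 1` that was awaited; after it, each segment adds `τ`. -/
theorem playTime_le {ω : Ω} (hA : (R.choice ω).Nonempty) (n : ℕ) :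
    R.playTime (n + 1) ω ≤ S.ds + n * S.τ ∨ ∃ j ∈ R.choice ω, ∃ p ≤ n,
      R.playTime (n + 1) ω - n * S.τ ≤ R.download j (p + 1) ω - p * S.τ := by
  have hseg : ∀ q, ∃ j ∈ R.choice ω, R.segmentDownload q ω = R.download j q ω := by
    intro q
    obtain ⟨j, hj, h⟩ := Finset.exists_mem_eq_sup' hA fun j => R.download j q ω
    exact ⟨j, hj, by simpa [segmentDownload, hA] using h⟩
  induction n with
  | zero =>
    obtain ⟨j, hj, h⟩ := hseg 1
    rcases max_choice S.ds (R.segmentDownload 1 ω) with h' | h'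
    · left; simp [playTime, h']
    · right
      refine ⟨j, hj, 0, le_rfl, ?_⟩
      rw [playTime, h', h]
  | succ n ih =>
    obtain ⟨j, hj, h⟩ := hseg (n + 2)
    rcases max_choice (R.playTime (n + 1) ω + S.τ) (R.segmentDownload (n + 2) ω) with h' | h'
    · rcases ih with ih | ⟨j', hj', p, hp, ih⟩
      · left
        simp only [playTime, h']
        push_cast
        linarith
      · right
        refine ⟨j', hj', p, by omega, ?_⟩
        simp only [playTime, h']
        push_cast
        linarith
    · right
      refine ⟨j, hj, n + 1, le_rfl, ?_⟩
      rw [playTime, h', h]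

theorem stall_eq {n : ℕ} (hn : S.L i = n + 1) (ω : Ω) :
    R.stall ω = R.playTime (n + 1) ω - S.ds - n * S.τ := by
  unfold stall
  rw [hn]
  push_cast
  ring

theorem stall_nonneg (ω : Ω) : 0 ≤ R.stall ω := by
  obtain ⟨n, hn⟩ := Nat.exists_eq_add_of_le' (S.L_pos i)
  rw [R.stall_eq hn]
  linarith [R.le_playTime n ω]

/-- One of the alternatives in `playTime_le` attains the maximum, and its exponential is a single
term of a nonnegative sum. The summand `1` covers the case of no stall. -/
theorem ofReal_exp_stall_le {ω : Ω} (hA : (R.choice ω).Nonempty) {t : ℝ} (ht : 0 < t) :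
    ENNReal.ofReal (Real.exp (t * R.stall ω)) ≤ ∑ j, {ω | j ∈ R.choice ω}.indicator 1 ω *
      (1 + ∑ p ∈ Finset.range (S.L i), ENNReal.ofReal (Real.exp (-t * (S.ds + p * S.τ)))
        * ENNReal.ofReal (Real.exp (t * R.download j (p + 1) ω))) := by
  obtain ⟨n, hn⟩ := Nat.exists_eq_add_of_le' (S.L_pos i)
  have key : ∃ j ∈ R.choice ω, ENNReal.ofReal (Real.exp (t * R.stall ω)) ≤
      1 + ∑ p ∈ Finset.range (S.L i), ENNReal.ofReal (Real.exp (-t * (S.ds + p * S.τ)))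
        * ENNReal.ofReal (Real.exp (t * R.download j (p + 1) ω)) := by
    rw [R.stall_eq hn]
    rcases R.playTime_le hA n with h | ⟨j, hj, p, hp, h⟩
    · obtain ⟨j, hj⟩ := hA
      refine ⟨j, hj, le_trans ?_ le_self_add⟩
      rw [ENNReal.ofReal_le_one, Real.exp_le_one_iff]
      exact mul_nonpos_of_nonneg_of_nonpos ht.le (by linarith)
    · refine ⟨j, hj, le_trans ?_ le_add_self⟩
      refine le_trans ?_ (Finset.single_le_sum (fun _ _ => zero_le)
        (Finset.mem_range.2 (by omega : p < S.L i)))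
      rw [← ENNReal.ofReal_mul (Real.exp_nonneg _), ← Real.exp_add]
      refine ENNReal.ofReal_le_ofReal (Real.exp_le_exp.2 ?_)
      nlinarith
  obtain ⟨j, hj, h⟩ := key
  refine h.trans (le_trans ?_ (Finset.single_le_sum (fun _ _ => zero_le) (Finset.mem_univ j)))
  rw [Set.indicator_of_mem (show ω ∈ {ω | j ∈ R.choice ω} from hj), Pi.one_apply, one_mul]

/-- Since `k i ≥ 1`, the policy gives the empty set no mass. On the empty set the sum over chosen
servers would be `0` and could not dominate the exponential. -/
theorem ae_choice_nonempty : ∀ᵐ ω ∂P, (R.choice ω).Nonempty := by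
  have h : P {ω | R.choice ω = ∅} = 0 := by
    rw [R.choice_law, ENNReal.ofReal_eq_zero]
    by_contra hne
    have h1 := (S.policy_support i ∅ (fun h0 => hne h0.le)).2
    have h2 := S.k_pos i
    simp at h1
    omega
  rw [ae_iff]
  simpa [Finset.not_nonempty_iff_eq_empty] using h

theorem measure_mem_choice (j : Fin m) : P {ω | j ∈ R.choice ω} = ENNReal.ofReal (S.usage i j) :=
  measure_mem_finset R.choice_measurable (S.policy_nonneg i) R.choice_law j

/-- Choice, backlog and chunks are independent of one another. The backlogs at different servers may
be dependent, but each term involves only one server. -/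
theorem lintegral_indicator_mul_exp_download (j : Fin m) (q : ℕ) {t : ℝ} (htα : t < S.α j) :
    ∫⁻ ω, {ω | j ∈ R.choice ω}.indicator 1 ω * ENNReal.ofReal (Real.exp (t * R.download j q ω)) ∂P
      = ENNReal.ofReal (S.usage i j) *
        (∫⁻ ω, ENNReal.ofReal (Real.exp (t * Q.backlog j s ω)) ∂P) * ENNReal.ofReal (S.M j t) ^ q
            := by
  have hC : MeasurableSet {ω | j ∈ R.choice ω} := measurable_mem_finset R.choice_measurable j
  have hCm : MeasurableSet[R.source .choice] {ω | j ∈ R.choice ω} :=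
    measurable_mem_finset (comap_measurable R.choice) j
  have hWm : Measurable[R.source .found] fun ω => ENNReal.ofReal (Real.exp (t * Q.backlog j s ω)) :=
    measurable_ofReal_exp_mul (R.measurable_source_wait j) t
  have hY : ∀ v, ∫⁻ ω, ENNReal.ofReal (Real.exp (t * R.chunk j v ω)) ∂P
      = ENNReal.ofReal (S.M j t) := fun v => by
    rw [(R.chunk_law j v).lintegral_comp
      (f := fun x => ENNReal.ofReal (Real.exp (t * x))) (by fun_prop),
      lintegral_exp_shiftedExp (S.α_pos j) htα]
    rfl
  have hpair := lintegral_mul_prod_of_iIndep R.source_le R.iIndep_source {.choice}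
    (fun _ : Unit => {.found}) (by simp) (fun k l hkl => absurd rfl hkl)
    (F₀ := {ω | j ∈ R.choice ω}.indicator 1)
    (F := fun _ ω => ENNReal.ofReal (Real.exp (t * Q.backlog j s ω)))
    (measurable_biSup_of_mem (m := R.source) (measurable_indicator_one hCm) rfl)
    (fun _ => measurable_biSup_of_mem (m := R.source) hWm rfl) Finset.univ
  have hprod := lintegral_mul_prod_of_iIndep R.source_le R.iIndep_source {.choice, .found}
    (fun v : ℕ => {.chunk j v}) (by simp) (by simp)
    (F₀ := fun ω => {ω | j ∈ R.choice ω}.indicator 1 ω *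
      ENNReal.ofReal (Real.exp (t * Q.backlog j s ω)))
    (F := fun v ω => ENNReal.ofReal (Real.exp (t * R.chunk j v ω)))
    (Measurable.mul
      (measurable_biSup_of_mem (m := R.source) (measurable_indicator_one hCm) (Or.inl rfl))
      (measurable_biSup_of_mem (m := R.source) hWm (Or.inr rfl)))
    (fun v => measurable_biSup_of_mem (m := R.source)
      (measurable_ofReal_exp_mul (comap_measurable (R.chunk j v)) t) rfl)
    (Finset.range q)
  simp only [Finset.univ_unique, Finset.prod_singleton] at hpair
  rw [hpair, lintegral_indicator_one hC, R.measure_mem_choice,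
    Finset.prod_congr rfl fun v _ => hY v, Finset.prod_const, Finset.card_range] at hprod
  rw [← hprod]
  refine lintegral_congr fun ω => ?_
  rw [download, wait, mul_add, Real.exp_add, ENNReal.ofReal_mul (Real.exp_nonneg _), Finset.mul_sum,
    Real.exp_sum, ENNReal.ofReal_prod_of_nonneg fun _ _ => Real.exp_nonneg _, mul_assoc]

variable [IsProbabilityMeasure P]

theorem lintegral_exp_stall_le {t : ℝ} (ht : 0 < t) (htα : ∀ j, t < S.α j) (hρ : ∀ j, S.rho j < 1)
    (hφ : ∀ j, S.phi j t < t) :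
    ∫⁻ ω, ENNReal.ofReal (Real.exp (t * R.stall ω)) ∂P
      ≤ ENNReal.ofReal (∑ j, S.usage i j * (1 + S.H i j t)) := by
  have hC : ∀ j, MeasurableSet {ω | j ∈ R.choice ω} := measurable_mem_finset R.choice_measurable
  have hI : ∀ j, Measurable ({ω | j ∈ R.choice ω}.indicator (1 : Ω → ℝ≥0∞)) :=
    fun j => measurable_indicator_one (hC j)
  have hD : ∀ j q, Measurable fun ω => ENNReal.ofReal (Real.exp (t * R.download j q ω)) :=
    fun j q => measurable_ofReal_exp_mul (R.measurable_download j q) t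
  have hID : ∀ j q, Measurable fun ω => {ω | j ∈ R.choice ω}.indicator (1 : Ω → ℝ≥0∞) ω *
      ENNReal.ofReal (Real.exp (t * R.download j q ω)) := fun j q => (hI j).mul (hD j q)
  have hsum : ∀ j, Measurable fun ω => {ω | j ∈ R.choice ω}.indicator (1 : Ω → ℝ≥0∞) ω *
      (1 + ∑ p ∈ Finset.range (S.L i), ENNReal.ofReal (Real.exp (-t * (S.ds + p * S.τ)))
        * ENNReal.ofReal (Real.exp (t * R.download j (p + 1) ω))) := fun j =>
    (hI j).mul (measurable_const.add
      (Finset.measurable_fun_sum _ fun p _ => (hD j (p + 1)).const_mul _))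
  have hw : ∀ j, 0 ≤ (1 - S.rho j) * t / (t - S.phi j t) := fun j =>
    div_nonneg (mul_nonneg (by linarith [hρ j]) ht.le) (by linarith [hφ j])
  have hserver : ∀ j, ∫⁻ ω, {ω | j ∈ R.choice ω}.indicator 1 ω *
      (1 + ∑ p ∈ Finset.range (S.L i), ENNReal.ofReal (Real.exp (-t * (S.ds + p * S.τ)))
        * ENNReal.ofReal (Real.exp (t * R.download j (p + 1) ω))) ∂P
      ≤ ENNReal.ofReal (S.usage i j * (1 + S.H i j t)) := by
    intro j
    have hterm : ∀ p : ℕ, ∫⁻ ω, ENNReal.ofReal (Real.exp (-t * (S.ds + p * S.τ))) *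
        ({ω | j ∈ R.choice ω}.indicator 1 ω
          * ENNReal.ofReal (Real.exp (t * R.download j (p + 1) ω))) ∂P
        ≤ ENNReal.ofReal (S.usage i j * (Real.exp (-t * (S.ds + p * S.τ))
          * ((1 - S.rho j) * t / (t - S.phi j t) * S.M j t ^ (p + 1)))) := by
      intro p
      rw [lintegral_const_mul _ (hID j (p + 1)),
        R.lintegral_indicator_mul_exp_download j (p + 1) (htα j)]
      calc _ ≤ ENNReal.ofReal (Real.exp (-t * (S.ds + p * S.τ))) * (ENNReal.ofReal (S.usage i j) *
            ENNReal.ofReal ((1 - S.rho j) * t / (t - S.phi j t))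
              * ENNReal.ofReal (S.M j t) ^ (p + 1)) := by
            gcongr
            exact Q.lintegral_exp_backlog_le j s ht (htα j) (hφ j)
        _ = _ := by
            rw [← ENNReal.ofReal_pow (S.M_nonneg (htα j)), ← ENNReal.ofReal_mul (S.usage_nonneg i
                j),
              ← ENNReal.ofReal_mul (mul_nonneg (S.usage_nonneg i j) (hw j)),
              ← ENNReal.ofReal_mul (Real.exp_nonneg _)]
            congr 1; ring
    have hexp : ∀ ω, {ω | j ∈ R.choice ω}.indicator (1 : Ω → ℝ≥0∞) ω *
      (1 + ∑ p ∈ Finset.range (S.L i), ENNReal.ofReal (Real.exp (-t * (S.ds + p * S.τ)))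
        * ENNReal.ofReal (Real.exp (t * R.download j (p + 1) ω)))
      = {ω | j ∈ R.choice ω}.indicator 1 ω + ∑ p ∈ Finset.range (S.L i),
        ENNReal.ofReal (Real.exp (-t * (S.ds + p * S.τ))) *
        ({ω | j ∈ R.choice ω}.indicator 1 ω
          * ENNReal.ofReal (Real.exp (t * R.download j (p + 1) ω))) := by
      intro ω
      rw [mul_add, mul_one, Finset.mul_sum]
      simp_rw [mul_left_comm]
    rw [lintegral_congr hexp, lintegral_add_left (hI j), lintegral_indicator_one (hC j),
      R.measure_mem_choice, lintegral_finsetSum _ fun p _ => (hID j (p + 1)).const_mul _]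
    have hnn : ∀ p : ℕ, 0 ≤ S.usage i j * (Real.exp (-t * (S.ds + p * S.τ))
          * ((1 - S.rho j) * t / (t - S.phi j t) * S.M j t ^ (p + 1))) := fun p =>
      mul_nonneg (S.usage_nonneg i j) (mul_nonneg (Real.exp_nonneg _)
        (mul_nonneg (hw j) (pow_nonneg (S.M_nonneg (htα j)) _)))
    refine (add_le_add le_rfl (Finset.sum_le_sum fun p _ => hterm p)).trans ?_
    rw [← ENNReal.ofReal_sum_of_nonneg fun p _ => hnn p, ← ENNReal.ofReal_add (S.usage_nonneg i j)
      (Finset.sum_nonneg fun p _ => hnn p), ← Finset.mul_sum]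
    refine ENNReal.ofReal_le_ofReal ?_
    -- An unused server contributes `0` on both sides whatever the value of `H`, whose `B` may then
    -- divide by zero.
    rcases (S.usage_nonneg i j).eq_or_lt with h0 | h0
    · simp [← h0]
    · rw [mul_add, mul_one]
      gcongr
      exact S.mul_sum_le_H (S.Lam_pos h0) ht (htα j) (hρ j) (hφ j)
  calc ∫⁻ ω, ENNReal.ofReal (Real.exp (t * R.stall ω)) ∂P
      ≤ ∫⁻ ω, ∑ j, {ω | j ∈ R.choice ω}.indicator 1 ω *
      (1 + ∑ p ∈ Finset.range (S.L i), ENNReal.ofReal (Real.exp (-t * (S.ds + p * S.τ)))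
        * ENNReal.ofReal (Real.exp (t * R.download j (p + 1) ω))) ∂P := by
        refine lintegral_mono_ae ?_
        filter_upwards [R.ae_choice_nonempty] with ω hω using R.ofReal_exp_stall_le hω ht
    _ ≤ ∑ j, ENNReal.ofReal (S.usage i j * (1 + S.H i j t)) := by
        rw [lintegral_finsetSum _ fun j _ => hsum j]
        exact Finset.sum_le_sum fun j _ => hserver j
    _ = _ := by
        refine (ENNReal.ofReal_sum_of_nonneg fun j _ => ?_).symm
        rcases (S.usage_nonneg i j).eq_or_lt with h0 | h0
        · simp [← h0]
        · have h1 := S.mul_sum_le_H (i := i) (S.Lam_pos h0) ht (htα j) (hρ j) (hφ j)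
          have h2 := Finset.sum_nonneg fun p (_ : p ∈ Finset.range (S.L i)) =>
            mul_nonneg (Real.exp_nonneg (-t * (S.ds + p * S.τ)))
              (mul_nonneg (hw j) (pow_nonneg (S.M_nonneg (htα j)) (p + 1)))
          exact mul_nonneg h0.le (by linarith)

end Request

/-! ### From the exponential moment to the mean. -/

/-- Jensen's inequality for the exponential function, with integrability as a conclusion. -/
theorem integrable_and_integral_le_log {Ω : Type*} [MeasurableSpace Ω] {P : Measure Ω}
    [IsProbabilityMeasure P] {X : Ω → ℝ} (hX : Measurable X) (hX0 : ∀ ω, 0 ≤ X ω) {t c : ℝ}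
    (ht : 0 < t) (h : ∫⁻ ω, ENNReal.ofReal (Real.exp (t * X ω)) ∂P ≤ ENNReal.ofReal c) :
    Integrable X P ∧ ∫ ω, X ω ∂P ≤ 1 / t * Real.log c := by
  have hexp : Integrable (fun ω => Real.exp (t * X ω)) P := by
    refine ⟨(by fun_prop : Measurable fun ω => Real.exp (t * X ω)).aestronglyMeasurable, ?_⟩
    rw [hasFiniteIntegral_iff_ofReal (Filter.Eventually.of_forall fun ω => Real.exp_nonneg _)]
    exact h.trans_lt ENNReal.ofReal_lt_top
  have hint : Integrable X P := by
    refine (hexp.const_mul (1 / t)).mono' hX.aestronglyMeasurable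
      (Filter.Eventually.of_forall fun ω => ?_)
    rw [Real.norm_of_nonneg (hX0 ω), one_div, ← div_eq_inv_mul, le_div_iff₀ ht]
    linarith [Real.add_one_le_exp (t * X ω)]
  refine ⟨hint, ?_⟩
  -- The integrand is at least `1` because `X ≥ 0`; this makes `Real.log c` meaningful.
  have hc1 : 1 ≤ c := by
    have h1 : (1 : ℝ≥0∞) ≤ ENNReal.ofReal c := by
      refine le_trans ?_ h
      calc (1 : ℝ≥0∞) = ∫⁻ _, 1 ∂P := by simp
        _ ≤ _ := lintegral_mono fun ω => ENNReal.one_le_ofReal.2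
          (Real.one_le_exp (mul_nonneg ht.le (hX0 ω)))
    exact ENNReal.one_le_ofReal.1 h1
  have hc : 0 < c := by linarith
  have hE : ∫ ω, Real.exp (t * X ω) ∂P ≤ c := by
    rw [integral_eq_lintegral_of_nonneg_ae (Filter.Eventually.of_forall fun ω => Real.exp_nonneg _)
      hexp.aestronglyMeasurable]
    exact ENNReal.toReal_le_of_le_ofReal hc.le h
  -- Tangent line of the exponential at `Real.log c`; the last term has mean at most `1`.
  have hpt : ∀ ω, t * X ω ≤ (Real.log c - 1) + Real.exp (t * X ω) / c := by
    intro ω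
    have h1 := Real.add_one_le_exp (t * X ω - Real.log c)
    rw [Real.exp_sub, Real.exp_log hc] at h1
    linarith
  have hle := integral_mono (hint.const_mul t)
    ((integrable_const (Real.log c - 1)).add (hexp.div_const c)) hpt
  rw [integral_const_mul, integral_add' (integrable_const _) (hexp.div_const c), integral_div]
    at hle
  have h2 : (∫ ω, Real.exp (t * X ω) ∂P) / c ≤ 1 := (div_le_one hc).2 hE
  simp only [integral_const, probReal_univ, smul_eq_mul, one_mul] at hle
  rw [one_div, ← div_eq_inv_mul, le_div_iff₀ ht]
  linarith

end VideoStall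

theorem theorem1 {r m : ℕ} (S : VideoStall.Params r m)
    {Ω : Type*} [MeasurableSpace Ω] (P : Measure Ω) [IsProbabilityMeasure P]
    (Q : VideoStall.SteadyStore S P) (i : Fin r) (s : ℝ≥0) (R : VideoStall.Request Q i s)
    (t : ℝ) (ht : 0 < t) (htα : ∀ j, t < S.α j) (hρ : ∀ j, S.rho j < 1)
    (hmgf : ∀ j, ∑ f, S.usage f j * (S.lam f : ℝ) *
      (S.α j * Real.exp (S.β j * t) / (S.α j - t)) ^ (S.L f) - (S.Lam j + t) < 0) :
    Integrable R.stall P ∧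
      ∫ ω, R.stall ω ∂P ≤ 1 / t * Real.log (∑ j, S.usage i j * (1 + S.H i j t)) := by
  -- The moment hypothesis says precisely that the denominator `t - φ(t)` is positive.
  have hφ : ∀ j, S.phi j t < t := by
    intro j
    have h := hmgf j
    rw [S.phi_eq]
    unfold VideoStall.Params.M
    linarith
  exact VideoStall.integrable_and_integral_le_log R.measurable_stall R.stall_nonneg ht
    (R.lintegral_exp_stall_le ht htα hρ hφ)
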